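/- Let $\Gamma\subset\mathbb{C}$ be a lattice with basis $2\omega_1,2\omega_3$, and let $T^2=\mathbb{C}/\Gamma$. A \emph{Euclidean minimal torus with planar ends and translational periods} is a smooth conformal immersion $f\colon\mathbb{C}\to\mathbb{R}^3\cup\{\infty\}$ into the conformal 3-sphere (smoothness and conformality at points of $f^{-1}(\infty)$ being tested after the inversion $x\mapsto x/|x|^2$, $\infty\mapsto 0$) which has vanishing mean curvature in $\mathbb{R}^3$ away from $f^{-1}(\infty)$ and for which, for every $\gamma\in\Gamma$, there is a (possibly zero) vector $t_\gamma\in\mathbb{R}^3$ with $f(z+\gamma)=f(z)+t_\gamma$ for all $z\in\mathbb{C}$ (with $\infty+t_\gamma=\infty$). Its \emph{ends} are the points of $T^2$ over which $f=\infty$. Its induced \emph{spin structure} is the homomorphism $h_0\in\mathrm{Hom}(\Gamma,\{\pm1\})$ for which there are functions $s_1,s_2$, holomorphic on $\mathbb{C}\setminus f^{-1}(\infty)$, with $s_j(z+\gamma)=h_0(\gamma)s_j(z)$ for $j=1,2$ and all $\gamma\in\Gamma$, such that $f$ has the Weierstrass representation \[ df=\operatorname{Re}\begin{pmatrix}2s_1s_2\,dz\\(s_1^2-s_2^2)\,dz\\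 i(s_1^2+s_2^2)\,dz\end{pmatrix}. \] Suppose that such an $f$ has exactly two ends in $T^2$. Then: (a) There is exactly one $h_0\in\mathrm{Hom}(\Gamma,\{\pm1\})$ with the above property, and it is nontrivial: $h_0\not\equiv 1$. (b) The two ends are located at two of the four half periods of the torus, when one of the ends is taken as the origin. That is, for either end $p$ the set of ends is $\{p,p+\omega\}$, where $\omega$ is one of the three nonzero half periods $\omega_1$, $\omega_1+\omega_3$, $\omega_3$ modulo $\Gamma$. -/

import Mathlib

open scoped ContDiff Matrix RealInnerProductSpace

noncomputable section

namespace MinimalTorus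

/-- Euclidean 3-space. -/
abbrev E3 : Type := EuclideanSpace ℝ (Fin 3)

/-- The conformal 3-sphere `ℝ³ ∪ {∞}`. -/
abbrev S3 : Type := OnePoint E3

/-- The affine chart of `ℝ³ ∪ {∞}`, defined on the complement of `∞` (junk value `0` at `∞`). -/
def affineChart (p : S3) : E3 := p.elim 0 id

/-- The chart of `ℝ³ ∪ {∞}` around `∞`, defined on the complement of the origin: `∞ ↦ 0` and
`x ↦ x / ‖x‖²` (inversion in the unit sphere). -/
def inversionChart (p : S3) : E3 := p.elim 0 (EuclideanGeometry.inversion (0 : E3) 1)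

/-- Partial derivative of a map on `ℂ` in the direction of the real axis, `z = x + i y`. -/
def dX (g : ℂ → E3) (z : ℂ) : E3 := fderiv ℝ g z 1

/-- Partial derivative of a map on `ℂ` in the direction of the imaginary axis, `z = x + i y`. -/
def dY (g : ℂ → E3) (z : ℂ) : E3 := fderiv ℝ g z Complex.I

/-- The unit normal `(g_x × g_y) / |g_x × g_y|` of a parametrized surface. -/
def unitNormal (g : ℂ → E3) (z : ℂ) : E3 :=
  let n : E3 := WithLp.toLp 2 ((dX g z).ofLp ⨯₃ (dY g z).ofLp)
  ‖n‖⁻¹ • n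

/-- The mean curvature `(e G - 2 f F + g E) / (2 (E G - F²))` of a parametrized surface, in terms
of the coefficients of its first and second fundamental forms. -/
def meanCurvature (g : ℂ → E3) (z : ℂ) : ℝ :=
  let E : ℝ := ⟪dX g z, dX g z⟫
  let F : ℝ := ⟪dX g z, dY g z⟫
  let G : ℝ := ⟪dY g z, dY g z⟫
  let l : ℝ := ⟪dX (dX g) z, unitNormal g z⟫
  let m : ℝ := ⟪dX (dY g) z, unitNormal g z⟫
  let n : ℝ := ⟪dY (dY g) z, unitNormal g z⟫
  (l * G - 2 * m * F + n * E) / (2 * (E * G - F ^ 2))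

/-- A smooth conformal immersion `f : ℂ → ℝ³ ∪ {∞}` into the conformal 3-sphere. Being smooth and
being conformal (with nonzero conformal factor, hence an immersion) are tested in the affine chart
where `f` is finite, and in the chart around `∞` where `f` passes through `∞`. -/
structure IsConformalImmersion (f : ℂ → S3) : Prop where
  continuous : Continuous f
  smooth_affine : ∀ z, f z ≠ OnePoint.infty → ContDiffAt ℝ ∞ (affineChart ∘ f) z
  conformal_affine : ∀ z, f z ≠ OnePoint.infty → ConformalAt (affineChart ∘ f) z
  smooth_infty : ∀ z, f z = OnePoint.infty → ContDiffAt ℝ ∞ (inversionChart ∘ f) z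
  conformal_infty : ∀ z, f z = OnePoint.infty → ConformalAt (inversionChart ∘ f) z

/-- The torus `ℂ / Γ`, where `Γ` is the lattice of the period pair `L`. -/
abbrev Torus (L : PeriodPair) : Type := ℂ ⧸ L.lattice

/-- The ends, as points of the torus: the places where `f` passes through `∞`. -/
def ends (L : PeriodPair) (f : ℂ → S3) : Set (Torus L) :=
  L.lattice.mkQ '' {z : ℂ | f z = OnePoint.infty}

/-- A Euclidean minimal torus `ℂ / Γ` with planar ends and (possibly vanishing) translational
periods, given as a map on the universal covering `ℂ`: a smooth conformal immersion into
`ℝ³ ∪ {∞}` that is minimal in `ℝ³` away from the ends, and that changes by a translation of `ℝ³`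
(which fixes `∞`) under each element of `Γ`. -/
structure IsMinimalTorusWithPlanarEnds (L : PeriodPair) (f : ℂ → S3) : Prop where
  immersion : IsConformalImmersion f
  minimal : ∀ z, f z ≠ OnePoint.infty → meanCurvature (affineChart ∘ f) z = 0
  periods : ∀ γ ∈ L.lattice, ∃ t : E3, ∀ z, f (z + γ) = OnePoint.map (fun x => x + t) (f z)

/-- `h ∈ Hom(Γ, ℤ₂)` is the spin structure induced by `f`: there are functions `s₁`, `s₂`,
holomorphic away from the ends and with monodromy `h`, such that `f` has the spinorial Weierstrass
representation
`df = Re (2 s₁ s₂ dz, (s₁² - s₂²) dz, i (s₁² + s₂²) dz)`. -/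
def IsInducedSpinStructure (L : PeriodPair) (f : ℂ → S3)
    (h : Multiplicative L.lattice →* ℤˣ) : Prop :=
  ∃ s₁ s₂ : ℂ → ℂ,
    DifferentiableOn ℂ s₁ {z | f z ≠ OnePoint.infty} ∧
    DifferentiableOn ℂ s₂ {z | f z ≠ OnePoint.infty} ∧
    (∀ (γ : L.lattice) (z : ℂ), f z ≠ OnePoint.infty →
      s₁ (z + γ) = ((h (Multiplicative.ofAdd γ) : ℤ) : ℂ) * s₁ z ∧
      s₂ (z + γ) = ((h (Multiplicative.ofAdd γ) : ℤ) : ℂ) * s₂ z) ∧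
    ∀ z : ℂ, f z ≠ OnePoint.infty → ∀ v : ℂ,
      fderiv ℝ (affineChart ∘ f) z v =
        !₂[(2 * s₁ z * s₂ z * v).re,
          ((s₁ z ^ 2 - s₂ z ^ 2) * v).re,
          (Complex.I * (s₁ z ^ 2 + s₂ z ^ 2) * v).re]

/-- The four half periods of the torus. -/
def halfPeriods (L : PeriodPair) : Set (Torus L) :=
  {0, L.lattice.mkQ (L.ω₁ / 2), L.lattice.mkQ ((L.ω₁ + L.ω₂) / 2), L.lattice.mkQ (L.ω₂ / 2)}

end MinimalTorus

end

/-!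
The vector `g_x - i g_y` of a conformal minimal immersion `g` is a holomorphic curve in the null
cone of `ℂ³`, and a spinor is a pair of square roots `(s₁, s₂)` of this curve `(A, B, C) =
(s₁², s₁ s₂, s₂²)`.

*Ends.* In the inverted chart the surface is a smooth conformal map `y` with a zero at the end.
Hence the null curve grows exactly like `|z - p|⁻²` and has a double pole. It has no residue
(`exists_planar_end_expansion`): the imaginary part of the residue would be a period of `g`, and
its real part would give `g` a logarithmic term, whereas `g(p + r) + g(p - r)` is bounded because
the inversion is odd. Consequently each spinor has an expansion `r / (z - p) + O(z - p)` at an end,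
with nonzero residue vector (`exists_hasOddPole`).

*The spin structure.* All orders of the null curve are even, so that square roots exist locally,
and they are unique up to a sign. On rectangles they are glued by subdivision, and an exhaustion
gives square roots on `ℂ` (`exists_isSpinorOn_univ`). Translating them by a lattice vector changes
them by a sign, which defines the induced spin structure.

*Two ends.* The residue vectors at the ends `p₁` and `p₂` are linearly independent, by Liouville's
theorem. Hence there are combinations `t₁`, `t₂` of `s₁` and `s₂` with a pole at `p₁` only and at
`p₂` only. As the null curve has no residues, `t₂` vanishes at `p₁` and `t₁` at `p₂`, so that
`t₁ t₂` is a nonzero constant and `t₁` has no zeros away from the ends. Moreover `t₁` is odd with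
respect to `p₁`, since `t₁(z) + t₁(2 p₁ - z)` is bounded and vanishes at `p₁`. If the spin structure
is trivial on a lattice vector `γ ∉ 2Γ`, then `t₁` takes equal values at `p₁ ± γ / 2`, and these
are also opposite; so `p₁ + γ / 2` is an end, namely `p₂` modulo `Γ`
(`IsTwoEndedSpinor.half_sub_mem_lattice`). A homomorphism to `{±1}` is trivial on one of `ω₁`, `ω₂`
and `ω₁ + ω₂`, which shows that the ends differ by a half period; if it were trivial on all three,
the ends would differ by several half periods at once.
-/

noncomputable section

namespace MinimalTorus

open Complex Filter Topology Set Metric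

/-! ### Functions with removable singularities on a closed discrete set -/

lemma isOpen_compl_of_eventually_notMem {P : Set ℂ} (hP : ∀ z, ∀ᶠ w in 𝓝[≠] z, w ∉ P) :
    IsOpen Pᶜ := by
  rw [isOpen_iff_mem_nhds]
  intro z hz
  filter_upwards [eventually_nhdsWithin_iff.1 (hP z)] with w hw
  by_cases hwz : w = z
  · rwa [hwz]
  · exact hw hwz

lemma analyticAt_update_limUnder {t : ℂ → ℂ} {p : ℂ} {M : ℝ}
    (ht : ∀ᶠ z in 𝓝[≠] p, DifferentiableAt ℂ t z) (hM : ∀ᶠ z in 𝓝[≠] p, ‖t z‖ ≤ M) :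
    AnalyticAt ℂ (Function.update t p (limUnder (𝓝[≠] p) t)) p := by
  have hs : insert p {z | DifferentiableAt ℂ t z ∧ ‖t z‖ ≤ M} ∈ 𝓝 p :=
    insert_mem_nhds_iff.2 (ht.and hM)
  have hd := differentiableOn_update_limUnder_of_bddAbove (f := t) hs
    (fun z hz => (hz.1.resolve_left hz.2).1.differentiableWithinAt)
    ⟨M, by rintro _ ⟨z, hz, rfl⟩; exact (hz.1.resolve_left hz.2).2⟩
  exact hd.analyticAt hs

lemma exists_analyticAt_eventuallyEq {t : ℂ → ℂ} {p : ℂ} {M : ℝ}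
    (ht : ∀ᶠ z in 𝓝[≠] p, DifferentiableAt ℂ t z) (hM : ∀ᶠ z in 𝓝[≠] p, ‖t z‖ ≤ M) :
    ∃ F, AnalyticAt ℂ F p ∧ F =ᶠ[𝓝[≠] p] t :=
  ⟨_, analyticAt_update_limUnder ht hM, by
    filter_upwards [self_mem_nhdsWithin] with z hz using Function.update_of_ne hz _ _⟩

/-- Riemann's theorem for all the points of a closed discrete set `P` at once. -/
lemma exists_differentiableOn_extension {P U : Set ℂ} (hP : ∀ z, ∀ᶠ w in 𝓝[≠] z, w ∉ P)
    (hU : IsOpen U) {t : ℂ → ℂ} (ht : DifferentiableOn ℂ t (U \ P))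
    (hb : ∀ p ∈ U ∩ P, ∃ M : ℝ, ∀ᶠ z in 𝓝[≠] p, ‖t z‖ ≤ M) :
    ∃ F : ℂ → ℂ, DifferentiableOn ℂ F U ∧ EqOn F t (U \ P) := by
  classical
  have hUP : IsOpen (U \ P) := hU.inter (isOpen_compl_of_eventually_notMem hP)
  refine ⟨fun z => if z ∈ P then limUnder (𝓝[≠] z) t else t z, ?_, fun z hz => by simp [hz.2]⟩
  intro p hp
  apply DifferentiableAt.differentiableWithinAt
  by_cases hpP : p ∈ P
  · obtain ⟨M, hM⟩ := hb p ⟨hp, hpP⟩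
    have hd : ∀ᶠ z in 𝓝[≠] p, DifferentiableAt ℂ t z := by
      filter_upwards [hP p, mem_nhdsWithin_of_mem_nhds (hU.mem_nhds hp)] with z a b
      exact ht.differentiableAt (hUP.mem_nhds ⟨b, a⟩)
    refine (analyticAt_update_limUnder hd hM).differentiableAt.congr_of_eventuallyEq ?_
    filter_upwards [eventually_nhdsWithin_iff.1 (hP p)] with z hz
    rcases eq_or_ne z p with rfl | h
    · simp [hpP]
    · simp [hz h, h]
  · refine (ht.differentiableAt (hUP.mem_nhds ⟨hp, hpP⟩)).congr_of_eventuallyEq ?_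
    filter_upwards [hUP.mem_nhds ⟨hp, hpP⟩] with z hz
    simp [hz.2]

/-! ### Square roots of null curves -/

/-- `s₁` and `s₂` are holomorphic on `U \ P` and `(s₁², s₁ s₂, s₂²) = (A, B, C)` there. -/
structure IsSpinorOn (P : Set ℂ) (A B C : ℂ → ℂ) (U : Set ℂ) (s₁ s₂ : ℂ → ℂ) : Prop where
  diff₁ : DifferentiableOn ℂ s₁ (U \ P)
  diff₂ : DifferentiableOn ℂ s₂ (U \ P)
  sq₁ : ∀ z ∈ U \ P, s₁ z ^ 2 = A z
  mul : ∀ z ∈ U \ P, s₁ z * s₂ z = B z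
  sq₂ : ∀ z ∈ U \ P, s₂ z ^ 2 = C z

section Spinor

variable {P : Set ℂ} {A B C : ℂ → ℂ} {U V : Set ℂ} {s₁ s₂ t₁ t₂ : ℂ → ℂ}

lemma IsSpinorOn.mono (h : IsSpinorOn P A B C U s₁ s₂) (hV : V ⊆ U) :
    IsSpinorOn P A B C V s₁ s₂ :=
  have hs : V \ P ⊆ U \ P := sdiff_subset_sdiff_left hV
  ⟨h.diff₁.mono hs, h.diff₂.mono hs, fun z hz => h.sq₁ z (hs hz), fun z hz => h.mul z (hs hz),
    fun z hz => h.sq₂ z (hs hz)⟩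

lemma IsSpinorOn.congr (h : IsSpinorOn P A B C U s₁ s₂) (h₁ : EqOn t₁ s₁ (U \ P))
    (h₂ : EqOn t₂ s₂ (U \ P)) : IsSpinorOn P A B C U t₁ t₂ :=
  ⟨h.diff₁.congr h₁, h.diff₂.congr h₂, fun z hz => by rw [h₁ hz, h.sq₁ z hz],
    fun z hz => by rw [h₁ hz, h₂ hz, h.mul z hz], fun z hz => by rw [h₂ hz, h.sq₂ z hz]⟩

lemma IsSpinorOn.smul (h : IsSpinorOn P A B C U s₁ s₂) {ε : ℂ} (hε : ε = 1 ∨ ε = -1) :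
    IsSpinorOn P A B C U (fun z => ε * s₁ z) (fun z => ε * s₂ z) := by
  have h2 : ε * ε = 1 := by rcases hε with rfl | rfl <;> norm_num
  refine ⟨h.diff₁.const_mul ε, h.diff₂.const_mul ε, fun z hz => ?_, fun z hz => ?_, fun z hz => ?_⟩
  · rw [← h.sq₁ z hz]; linear_combination s₁ z ^ 2 * h2
  · rw [← h.mul z hz]; linear_combination s₁ z * s₂ z * h2
  · rw [← h.sq₂ z hz]; linear_combination s₂ z ^ 2 * h2

lemma IsSpinorOn.union (hU : IsSpinorOn P A B C U s₁ s₂) (hV : IsSpinorOn P A B C V s₁ s₂)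
    (hUP : IsOpen (U \ P)) (hVP : IsOpen (V \ P)) : IsSpinorOn P A B C (U ∪ V) s₁ s₂ := by
  have key : (U ∪ V) \ P = (U \ P) ∪ (V \ P) := union_sdiff_distrib
  refine ⟨?_, ?_, ?_, ?_, ?_⟩
  · rw [key]; exact hU.diff₁.union_of_isOpen hV.diff₁ hUP hVP
  · rw [key]; exact hU.diff₂.union_of_isOpen hV.diff₂ hUP hVP
  all_goals rw [key]; rintro z (hz | hz)
  exacts [hU.sq₁ z hz, hV.sq₁ z hz, hU.mul z hz, hV.mul z hz, hU.sq₂ z hz, hV.sq₂ z hz]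

/-- Two square roots of a null curve agree up to one global sign: the sign extends holomorphically
across the discrete set `P`, and is constant because it only takes the values `1` and `-1`. -/
lemma IsSpinorOn.exists_sign (hP : ∀ z, ∀ᶠ w in 𝓝[≠] z, w ∉ P) (hU : IsOpen U)
    (hc : IsPreconnected U) (h0 : ∀ z ∈ U \ P, A z ≠ 0 ∨ C z ≠ 0)
    (hs : IsSpinorOn P A B C U s₁ s₂) (ht : IsSpinorOn P A B C U t₁ t₂) :
    ∃ ε : ℂ, (ε = 1 ∨ ε = -1) ∧ ∀ z ∈ U \ P, t₁ z = ε * s₁ z ∧ t₂ z = ε * s₂ z := by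
  classical
  have hUP : IsOpen (U \ P) := hU.inter (isOpen_compl_of_eventually_notMem hP)
  have hpt : ∀ z ∈ U \ P, (s₁ z ≠ 0 ∨ s₂ z ≠ 0) ∧
      ∃ ε : ℂ, (ε = 1 ∨ ε = -1) ∧ t₁ z = ε * s₁ z ∧ t₂ z = ε * s₂ z := by
    intro z hz
    have e1 : t₁ z ^ 2 = s₁ z ^ 2 := by rw [hs.sq₁ z hz, ht.sq₁ z hz]
    have e2 : t₂ z ^ 2 = s₂ z ^ 2 := by rw [hs.sq₂ z hz, ht.sq₂ z hz]
    have e3 : t₁ z * t₂ z = s₁ z * s₂ z := by rw [hs.mul z hz, ht.mul z hz]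
    have hne : s₁ z ≠ 0 ∨ s₂ z ≠ 0 := by
      have := h0 z hz
      rw [← hs.sq₁ z hz, ← hs.sq₂ z hz] at this
      simpa using this
    refine ⟨hne, ?_⟩
    rcases hne with h | h
    · rcases sq_eq_sq_iff_eq_or_eq_neg.1 e1 with h1 | h1
      · refine ⟨1, Or.inl rfl, by simp [h1], ?_⟩
        rw [h1] at e3; simpa using mul_left_cancel₀ h e3
      · refine ⟨-1, Or.inr rfl, by simp [h1], ?_⟩
        rw [h1] at e3
        exact mul_left_cancel₀ h (by linear_combination -e3)
    · rcases sq_eq_sq_iff_eq_or_eq_neg.1 e2 with h1 | h1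
      · refine ⟨1, Or.inl rfl, ?_, by simp [h1]⟩
        rw [h1] at e3; simpa using mul_right_cancel₀ h e3
      · refine ⟨-1, Or.inr rfl, ?_, by simp [h1]⟩
        rw [h1] at e3
        exact mul_right_cancel₀ h (by linear_combination -e3)
  let ε : ℂ → ℂ := fun z => if s₁ z ≠ 0 then t₁ z / s₁ z else t₂ z / s₂ z
  have hε : ∀ z ∈ U \ P, (ε z = 1 ∨ ε z = -1) ∧ t₁ z = ε z * s₁ z ∧ t₂ z = ε z * s₂ z := by
    intro z hz
    obtain ⟨hne, e, he, h1, h2⟩ := hpt z hz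
    have : ε z = e := by
      simp only [ε]
      split_ifs with h
      · rw [h1]; field_simp
      · have h := hne.resolve_left h
        rw [h2]; field_simp
    rw [this]; exact ⟨he, h1, h2⟩
  have hεd : DifferentiableOn ℂ ε (U \ P) := by
    intro z hz
    have d {g : ℂ → ℂ} (hg : DifferentiableOn ℂ g (U \ P)) : DifferentiableAt ℂ g z :=
      hg.differentiableAt (hUP.mem_nhds hz)
    apply DifferentiableAt.differentiableWithinAt
    rcases (hpt z hz).1 with h | h
    · refine ((d ht.diff₁).div (d hs.diff₁) h).congr_of_eventuallyEq ?_
      filter_upwards [hUP.mem_nhds hz, (d hs.diff₁).continuousAt.eventually_ne h] with w hw h'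
      simp [(hε w hw).2.1, h']
    · refine ((d ht.diff₂).div (d hs.diff₂) h).congr_of_eventuallyEq ?_
      filter_upwards [hUP.mem_nhds hz, (d hs.diff₂).continuousAt.eventually_ne h] with w hw h'
      simp [(hε w hw).2.2, h']
  obtain ⟨F, hF, hFε⟩ := exists_differentiableOn_extension hP hU hεd (fun p hp => ⟨1, by
    filter_upwards [hP p, mem_nhdsWithin_of_mem_nhds (hU.mem_nhds hp.1)] with z a b
    rcases (hε z ⟨b, a⟩).1 with h | h <;> simp [h]⟩)
  have hF2 : ∀ z ∈ U, F z = 1 ∨ F z = -1 := by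
    intro z hz
    rw [← sq_eq_one_iff]
    have hcont : ContinuousAt F z := (hF.differentiableAt (hU.mem_nhds hz)).continuousAt
    refine tendsto_nhds_unique (l := 𝓝[≠] z)
      ((hcont.pow 2).tendsto.mono_left nhdsWithin_le_nhds) ?_
    refine tendsto_const_nhds.congr' ?_
    filter_upwards [hP z, mem_nhdsWithin_of_mem_nhds (hU.mem_nhds hz)] with w a b
    rw [Pi.pow_apply, hFε ⟨b, a⟩]
    rcases (hε w ⟨b, a⟩).1 with h | h <;> simp [h]
  rcases hc.eq_one_or_eq_neg_one_of_sq_eq (f := F) hF.continuousOn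
    (fun z hz => by simpa using sq_eq_one_iff.2 (hF2 z hz)) with h | h
  · refine ⟨1, Or.inl rfl, fun z hz => ?_⟩
    have := (hε z hz).2
    rwa [← hFε hz, h hz.1] at this
  · refine ⟨-1, Or.inr rfl, fun z hz => ?_⟩
    have := (hε z hz).2
    rwa [← hFε hz, h hz.1] at this

lemma exists_isSpinorOn_union (hP : ∀ z, ∀ᶠ w in 𝓝[≠] z, w ∉ P) (hU : IsOpen U) (hV : IsOpen V)
    (hc : IsPreconnected (U ∩ V)) (h0 : ∀ z ∉ P, A z ≠ 0 ∨ C z ≠ 0)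
    (hs : IsSpinorOn P A B C U s₁ s₂) (ht : IsSpinorOn P A B C V t₁ t₂) :
    ∃ u₁ u₂, IsSpinorOn P A B C (U ∪ V) u₁ u₂ := by
  classical
  have hPo := isOpen_compl_of_eventually_notMem hP
  obtain ⟨ε, hε, h⟩ := (hs.mono inter_subset_left).exists_sign hP (hU.inter hV) hc
    (fun z hz => h0 z hz.2) (ht.mono inter_subset_right)
  have h2 : ε * ε = 1 := by rcases hε with rfl | rfl <;> norm_num
  refine ⟨fun z => if z ∈ U then s₁ z else ε * t₁ z, fun z => if z ∈ U then s₂ z else ε * t₂ z,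
    IsSpinorOn.union (hs.congr ?_ ?_) ((ht.smul hε).congr ?_ ?_) (hU.inter hPo) (hV.inter hPo)⟩
  · exact fun z hz => by simp [hz.1]
  · exact fun z hz => by simp [hz.1]
  · intro z hz
    by_cases hzU : z ∈ U
    · simp only [hzU, if_true, (h z ⟨⟨hzU, hz.1⟩, hz.2⟩).1]
      linear_combination -s₁ z * h2
    · simp [hzU]
  · intro z hz
    by_cases hzU : z ∈ U
    · simp only [hzU, if_true, (h z ⟨⟨hzU, hz.1⟩, hz.2⟩).2]
      linear_combination -s₂ z * h2
    · simp [hzU]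

end Spinor

lemma exists_analyticAt_sq_eq {a : ℂ → ℂ} {p : ℂ} (ha : AnalyticAt ℂ a p) (h0 : a p ≠ 0) :
    ∃ σ : ℂ → ℂ, AnalyticAt ℂ σ p ∧ ∀ᶠ z in 𝓝 p, σ z ≠ 0 ∧ σ z ^ 2 = a z := by
  have hq : AnalyticAt ℂ (fun z => a z / a p) p := ha.div analyticAt_const h0
  have hl : AnalyticAt ℂ (fun z => Complex.log (a z / a p)) p :=
    hq.clog (by simp [div_self h0])
  refine ⟨fun z => Complex.exp ((Complex.log (a z / a p) + Complex.log (a p)) / 2), ?_, ?_⟩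
  · exact ((hl.add analyticAt_const).div analyticAt_const two_ne_zero).cexp
  · filter_upwards [ha.continuousAt.eventually_ne h0] with z hz
    refine ⟨Complex.exp_ne_zero _, ?_⟩
    rw [← Complex.exp_nat_mul]
    push_cast
    rw [mul_div_cancel₀ _ two_ne_zero, Complex.exp_add, Complex.exp_log (div_ne_zero hz h0),
      Complex.exp_log h0, div_mul_cancel₀ _ h0]

/-- The square root of a null curve near a point where its first component has even order. -/
lemma exists_isSpinorOn_ball_of_left {P : Set ℂ} {A B C : ℂ → ℂ}
    (hP : ∀ z, ∀ᶠ w in 𝓝[≠] z, w ∉ P)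
    (hB : DifferentiableOn ℂ B Pᶜ) (hnull : ∀ z ∉ P, B z ^ 2 = A z * C z)
    {p : ℂ} {n : ℕ} (hn : p ∉ P → n = 0) {a : ℂ → ℂ} (ha : AnalyticAt ℂ a p) (h0 : a p ≠ 0)
    (hA : ∀ᶠ z in 𝓝 p, z ∉ P → A z = a z / ((z - p) ^ n) ^ 2) :
    ∃ r > 0, ∃ s₁ s₂, IsSpinorOn P A B C (ball p r) s₁ s₂ := by
  have hPo := isOpen_compl_of_eventually_notMem hP
  obtain ⟨σ, hσ, hσ2⟩ := exists_analyticAt_sq_eq ha h0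
  obtain ⟨r, hr, hball⟩ := Metric.eventually_nhds_iff_ball.1
    (hσ2.and (hA.and hσ.eventually_analyticAt))
  have hpow : ∀ z ∉ P, (z - p) ^ n ≠ 0 := by
    intro z hz
    by_cases hp : p ∈ P
    · exact pow_ne_zero _ (sub_ne_zero.2 fun h => hz (h ▸ hp))
    · simp [hn hp]
  have hs0 : ∀ z ∈ ball p r \ P, σ z / (z - p) ^ n ≠ 0 := fun z hz =>
    div_ne_zero (hball z hz.1).1.1 (hpow z hz.2)
  have hs : DifferentiableOn ℂ (fun z => σ z / (z - p) ^ n) (ball p r \ P) := by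
    intro z hz
    apply DifferentiableAt.differentiableWithinAt
    exact (hball z hz.1).2.2.differentiableAt.div (by fun_prop) (hpow z hz.2)
  have hA' : ∀ z ∈ ball p r \ P, (σ z / (z - p) ^ n) ^ 2 = A z := by
    intro z hz
    rw [(hball z hz.1).2.1 hz.2, div_pow, (hball z hz.1).1.2]
  refine ⟨r, hr, fun z => σ z / (z - p) ^ n, fun z => B z / (σ z / (z - p) ^ n), hs,
    (hB.mono fun z hz => hz.2).div hs hs0, hA', fun z hz => ?_, fun z hz => ?_⟩
  · exact mul_div_cancel₀ _ (hs0 z hz)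
  · have := hA' z hz
    have h1 := hs0 z hz
    rw [div_pow, hnull z hz.2, ← this]
    exact mul_div_cancel_left₀ _ (pow_ne_zero _ h1)

/-- A property of intervals that holds for all short intervals around each point, and for the union
of two adjacent intervals if it holds for both, holds for every interval. -/
lemma interval_induction {Q : ℝ → ℝ → Prop}
    (glue : ∀ a b c, a ≤ b → b ≤ c → Q a b → Q b c → Q a c)
    (loc : ∀ x, ∃ ε > 0, ∀ a b, x - ε < a → a ≤ x → x ≤ b → b < x + ε → Q a b)
    {a b : ℝ} (hab : a ≤ b) : Q a b := by
  by_contra hQ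
  set S : Set ℝ := {x | x ∈ Icc a b ∧ Q a x} with hS
  have hne : a ∈ S := by
    obtain ⟨ε, hε, h⟩ := loc a
    exact ⟨⟨le_rfl, hab⟩, h a a (by linarith) le_rfl le_rfl (by linarith)⟩
  have hbdd : BddAbove S := ⟨b, fun x hx => hx.1.2⟩
  set c := sSup S with hc
  have hac : a ≤ c := le_csSup hbdd hne
  have hcb : c ≤ b := csSup_le ⟨a, hne⟩ fun x hx => hx.1.2
  obtain ⟨ε, hε, h⟩ := loc c
  obtain ⟨x, hx, hxc⟩ := exists_lt_of_lt_csSup ⟨a, hne⟩ (show c - ε < sSup S by linarith)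
  have hxc' : x ≤ c := le_csSup hbdd hx
  have hstep : ∀ y, c ≤ y → y < c + ε → Q a y := fun y h1 h2 =>
    glue a x y hx.1.1 (hxc'.trans h1) hx.2 (h x y hxc hxc' h1 h2)
  rcases hcb.eq_or_lt with e | e
  · exact hQ (e ▸ hstep c le_rfl (by linarith))
  · have hm : min (c + ε / 2) b ∈ S := by
      have h1 : c ≤ min (c + ε / 2) b := le_min (by linarith) hcb
      exact ⟨⟨hac.trans h1, min_le_right _ _⟩,
        hstep _ h1 ((min_le_left _ _).trans_lt (by linarith))⟩
    have := le_csSup hbdd hm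
    rcases min_choice (c + ε / 2) b with h' | h' <;> rw [h'] at this <;> linarith

/-- If square roots exist near every point, they exist on every rectangle: rectangles are glued
along their edges, in the vertical and then in the horizontal direction. -/
lemma exists_isSpinorOn_rectangle {P : Set ℂ} {A B C : ℂ → ℂ}
    (hP : ∀ z, ∀ᶠ w in 𝓝[≠] z, w ∉ P) (h0 : ∀ z ∉ P, A z ≠ 0 ∨ C z ≠ 0)
    (hloc : ∀ p, ∃ r > 0, ∃ s₁ s₂, IsSpinorOn P A B C (ball p r) s₁ s₂)
    {a b c d : ℝ} (hab : a ≤ b) (hcd : c ≤ d) :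
    ∃ s₁ s₂, IsSpinorOn P A B C (Icc a b ×ℂ Icc c d) s₁ s₂ := by
  have hglue : ∀ {U V W : Set ℂ}, IsOpen U → IsOpen V → Convex ℝ U → Convex ℝ V → W ⊆ U ∪ V →
      (∃ s₁ s₂, IsSpinorOn P A B C U s₁ s₂) → (∃ s₁ s₂, IsSpinorOn P A B C V s₁ s₂) →
      ∃ s₁ s₂, IsSpinorOn P A B C W s₁ s₂ := by
    rintro U V W hU hV hUc hVc hW ⟨s₁, s₂, hs⟩ ⟨t₁, t₂, ht⟩
    obtain ⟨u₁, u₂, hu⟩ := exists_isSpinorOn_union hP hU hV (hUc.inter hVc).isPreconnected h0 hs ht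
    exact ⟨u₁, u₂, hu.mono hW⟩
  have hopen : ∀ a b c d : ℝ, IsOpen (Ioo a b ×ℂ Ioo c d) := fun a b c d =>
    isOpen_Ioo.reProdIm isOpen_Ioo
  have hconv : ∀ a b c d : ℝ, Convex ℝ (Ioo a b ×ℂ Ioo c d) := fun a b c d =>
    ((convex_Ioo a b).linear_preimage reLm).inter ((convex_Ioo c d).linear_preimage imLm)
  have hcol : ∀ x : ℝ, ∀ {c d : ℝ}, c ≤ d → ∃ ε > 0, ∃ s₁ s₂,
      IsSpinorOn P A B C (Ioo (x - ε) (x + ε) ×ℂ Ioo (c - ε) (d + ε)) s₁ s₂ := by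
    intro x c d hcd
    refine interval_induction (Q := fun c d => ∃ ε > 0, ∃ s₁ s₂,
      IsSpinorOn P A B C (Ioo (x - ε) (x + ε) ×ℂ Ioo (c - ε) (d + ε)) s₁ s₂) ?_ ?_ hcd
    · rintro c d e hcd hde ⟨ε, hε, h1⟩ ⟨δ, hδ, h2⟩
      refine ⟨min ε δ, lt_min hε hδ, hglue (hopen _ _ _ _) (hopen _ _ _ _) (hconv _ _ _ _)
        (hconv _ _ _ _) ?_ h1 h2⟩
      rintro z ⟨⟨h1, h2⟩, h3, h4⟩
      have := min_le_left ε δ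
      have := min_le_right ε δ
      rcases lt_or_ge z.im (d + ε) with h | h
      · exact Or.inl ⟨⟨by linarith, by linarith⟩, by linarith, h⟩
      · exact Or.inr ⟨⟨by linarith, by linarith⟩, by linarith, by linarith⟩
    · intro y
      obtain ⟨r, hr, s₁, s₂, hs⟩ := hloc ⟨x, y⟩
      refine ⟨r / 4, by positivity, fun a b h1 h2 h3 h4 => ⟨r / 4, by positivity, s₁, s₂,
        hs.mono ?_⟩⟩
      rintro z ⟨⟨h5, h6⟩, h7, h8⟩
      rw [mem_ball, dist_eq]
      have e1 : |(z - ⟨x, y⟩).re| < r / 4 := by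
        rw [sub_re, abs_lt]; constructor <;> linarith
      have e2 : |(z - ⟨x, y⟩).im| < r / 2 := by
        rw [sub_im, abs_lt]; constructor <;> simp <;> linarith
      linarith [Complex.norm_le_abs_re_add_abs_im (z - ⟨x, y⟩)]
  obtain ⟨ε, hε, s₁, s₂, hs⟩ := interval_induction (Q := fun a b => ∃ ε > 0, ∃ s₁ s₂,
      IsSpinorOn P A B C (Ioo (a - ε) (b + ε) ×ℂ Ioo (c - ε) (d + ε)) s₁ s₂) (by
    rintro a b e hab hbe ⟨ε, hε, h1⟩ ⟨δ, hδ, h2⟩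
    refine ⟨min ε δ, lt_min hε hδ, hglue (hopen _ _ _ _) (hopen _ _ _ _) (hconv _ _ _ _)
      (hconv _ _ _ _) ?_ h1 h2⟩
    rintro z ⟨⟨h1, h2⟩, h3, h4⟩
    have := min_le_left ε δ
    have := min_le_right ε δ
    rcases lt_or_ge z.re (b + ε) with h | h
    · exact Or.inl ⟨⟨by linarith, h⟩, by linarith, by linarith⟩
    · exact Or.inr ⟨⟨by linarith, by linarith⟩, by linarith, by linarith⟩) (by
    intro x
    obtain ⟨ε, hε, s₁, s₂, hs⟩ := hcol x hcd
    refine ⟨ε / 2, by positivity, fun a b h1 h2 h3 h4 => ⟨ε / 2, by positivity, s₁, s₂,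
      hs.mono ?_⟩⟩
    rintro z ⟨⟨h5, h6⟩, h7, h8⟩
    exact ⟨⟨by linarith, by linarith⟩, by linarith, by linarith⟩) hab
  refine ⟨s₁, s₂, hs.mono ?_⟩
  rintro z ⟨⟨h5, h6⟩, h7, h8⟩
  exact ⟨⟨by linarith, by linarith⟩, by linarith, by linarith⟩

/-- Square roots on the members of an exhaustion of `ℂ` are normalised at a base point, and then
fit together. -/
lemma exists_isSpinorOn_univ {P : Set ℂ} {A B C : ℂ → ℂ}
    (hP : ∀ z, ∀ᶠ w in 𝓝[≠] z, w ∉ P) (h0 : ∀ z ∉ P, A z ≠ 0 ∨ C z ≠ 0)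
    (hloc : ∀ p, ∃ r > 0, ∃ s₁ s₂, IsSpinorOn P A B C (ball p r) s₁ s₂) :
    ∃ s₁ s₂, IsSpinorOn P A B C univ s₁ s₂ := by
  have hPo := isOpen_compl_of_eventually_notMem hP
  have hball : ∀ n : ℕ, ∃ s₁ s₂, IsSpinorOn P A B C (ball 0 (n + 1)) s₁ s₂ := by
    intro n
    have hn : (-(n + 1) : ℝ) ≤ n + 1 := by linarith [n.cast_nonneg (α := ℝ)]
    obtain ⟨s₁, s₂, hs⟩ := exists_isSpinorOn_rectangle hP h0 hloc hn hn
    refine ⟨s₁, s₂, hs.mono fun z hz => ?_⟩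
    rw [mem_ball_zero_iff] at hz
    exact ⟨abs_le.1 ((abs_re_le_norm z).trans hz.le), abs_le.1 ((abs_im_le_norm z).trans hz.le)⟩
  obtain ⟨z₀, hz₀, hz₀P⟩ : ∃ z ∈ ball (0 : ℂ) 1, z ∉ P := by
    have h := (hP 0).and (mem_nhdsWithin_of_mem_nhds (ball_mem_nhds (0 : ℂ) one_pos))
    obtain ⟨z, h1, h2⟩ := h.exists
    exact ⟨z, h2, h1⟩
  have hz₀n : ∀ n : ℕ, z₀ ∈ ball (0 : ℂ) (n + 1) \ P := fun n =>
    ⟨ball_subset_ball (by linarith [n.cast_nonneg (α := ℝ)]) hz₀, hz₀P⟩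
  have hsub : ∀ {n m : ℕ}, n ≤ m → ball (0 : ℂ) (n + 1) ⊆ ball 0 (m + 1) := fun h =>
    ball_subset_ball (by exact_mod_cast Nat.succ_le_succ h)
  obtain ⟨a₁, a₂, ha⟩ := hball 0
  have hnorm : ∀ n : ℕ, ∃ s : (ℂ → ℂ) × (ℂ → ℂ), IsSpinorOn P A B C (ball 0 (n + 1)) s.1 s.2 ∧
      s.1 z₀ = a₁ z₀ ∧ s.2 z₀ = a₂ z₀ := by
    intro n
    obtain ⟨t₁, t₂, ht⟩ := hball n
    obtain ⟨ε, hε, h⟩ := (ht.mono (hsub n.zero_le)).exists_sign hP isOpen_ball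
      (convex_ball _ _).isPreconnected (fun z hz => h0 z hz.2) ha
    exact ⟨⟨_, _⟩, ht.smul hε, (h z₀ (hz₀n 0)).1.symm, (h z₀ (hz₀n 0)).2.symm⟩
  choose s hs hs1 hs2 using hnorm
  have hcomp : ∀ n m : ℕ, n ≤ m → ∀ z ∈ ball (0 : ℂ) (n + 1) \ P,
      (s m).1 z = (s n).1 z ∧ (s m).2 z = (s n).2 z := by
    intro n m hnm
    obtain ⟨ε, -, h⟩ := (hs n).exists_sign hP isOpen_ball
      (convex_ball _ _).isPreconnected (fun z hz => h0 z hz.2) ((hs m).mono (hsub hnm))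
    have hε1 : ε = 1 := by
      have e := h z₀ (hz₀n n)
      rw [hs1, hs1, hs2, hs2] at e
      rcases h0 z₀ hz₀P with hA | hC
      · rw [← ha.sq₁ z₀ (hz₀n 0)] at hA
        exact (mul_eq_right₀ (fun h => hA (by simp [h]))).1 e.1.symm
      · rw [← ha.sq₂ z₀ (hz₀n 0)] at hC
        exact (mul_eq_right₀ (fun h => hC (by simp [h]))).1 e.2.symm
    simpa [hε1] using h
  let N : ℂ → ℕ := fun z => ⌈‖z‖⌉₊
  have hN : ∀ z, z ∈ ball (0 : ℂ) (N z + 1) := fun z => by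
    rw [mem_ball_zero_iff]; linarith [Nat.le_ceil ‖z‖]
  have hglob : ∀ n : ℕ, ∀ z ∈ ball (0 : ℂ) (n + 1) \ P,
      (s (N z)).1 z = (s n).1 z ∧ (s (N z)).2 z = (s n).2 z := by
    intro n z hz
    rcases le_total n (N z) with h | h
    · exact hcomp n _ h z hz
    · have := hcomp _ n h z ⟨hN z, hz.2⟩
      exact ⟨this.1.symm, this.2.symm⟩
  have hfin : ∀ n : ℕ, IsSpinorOn P A B C (ball 0 (n + 1)) (fun z => (s (N z)).1 z)
      (fun z => (s (N z)).2 z) := fun n =>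
    (hs n).congr (fun z hz => (hglob n z hz).1) (fun z hz => (hglob n z hz).2)
  refine ⟨_, _, ?_, ?_, fun z hz => (hfin (N z)).sq₁ z ⟨hN z, hz.2⟩,
    fun z hz => (hfin (N z)).mul z ⟨hN z, hz.2⟩, fun z hz => (hfin (N z)).sq₂ z ⟨hN z, hz.2⟩⟩
  · exact fun z hz => ((hfin (N z)).diff₁.differentiableAt
      ((isOpen_ball.inter hPo).mem_nhds ⟨hN z, hz.2⟩)).differentiableWithinAt
  · exact fun z hz => ((hfin (N z)).diff₂.differentiableAt
      ((isOpen_ball.inter hPo).mem_nhds ⟨hN z, hz.2⟩)).differentiableWithinAt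

/-! ### Liouville's theorem on a torus -/

lemma tendsto_add_const_nhdsNE (p γ : ℂ) : Tendsto (fun z => z + γ) (𝓝[≠] p) (𝓝[≠] (p + γ)) :=
  tendsto_nhdsWithin_of_tendsto_nhds_of_eventually_within _
    ((Continuous.tendsto (by fun_prop) p).mono_left nhdsWithin_le_nhds)
    (by filter_upwards [self_mem_nhdsWithin] with z hz; simpa using hz)

lemma tendsto_const_sub_nhdsNE (p a : ℂ) : Tendsto (fun z => a - z) (𝓝[≠] p) (𝓝[≠] (a - p)) :=
  tendsto_nhdsWithin_of_tendsto_nhds_of_eventually_within _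
    ((Continuous.tendsto (by fun_prop) p).mono_left nhdsWithin_le_nhds)
    (by filter_upwards [self_mem_nhdsWithin] with z hz; simpa using hz)

lemma exists_eventually_norm_le_of_tendsto {t : ℂ → ℂ} {p l : ℂ} (h : Tendsto t (𝓝[≠] p) (𝓝 l)) :
    ∃ M : ℝ, ∀ᶠ z in 𝓝[≠] p, ‖t z‖ ≤ M :=
  ⟨‖l‖ + 1, (h.norm.eventually_lt_const (lt_add_one ‖l‖)).mono fun _ => le_of_lt⟩

lemma eq_const_of_norm_periodic (L : PeriodPair) {F : ℂ → ℂ} (hF : Differentiable ℂ F)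
    (hper : ∀ γ ∈ L.lattice, ∀ z, ‖F (z + γ)‖ = ‖F z‖) (z w : ℂ) : F z = F w := by
  refine hF.apply_eq_apply_of_bounded ?_ z w
  obtain ⟨R, hR⟩ := (ZSpan.fundamentalDomain_isBounded L.basis).subset_closedBall 0
  obtain ⟨M, hM⟩ :=
    ((isCompact_closedBall (0 : ℂ) R).image hF.continuous).isBounded.subset_closedBall 0
  refine isBounded_iff_forall_norm_le.2 ⟨M, ?_⟩
  rintro _ ⟨z, rfl⟩
  have h1 : ZSpan.fract L.basis z ∈ closedBall (0 : ℂ) R :=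
    hR (ZSpan.fract_mem_fundamentalDomain L.basis z)
  have h2 : (ZSpan.floor L.basis z : ℂ) ∈ L.lattice := by
    rw [L.lattice_eq_span_range_basis]; exact (ZSpan.floor L.basis z).2
  have h3 : ZSpan.fract L.basis z + ZSpan.floor L.basis z = z := by simp [ZSpan.fract]
  rw [← h3, hper _ h2]
  simpa using hM (mem_image_of_mem F h1)

/-- Liouville's theorem for a function on the complement of a `Γ`-invariant discrete set with
`Γ`-periodic modulus, bounded near the points of that set. -/
lemma exists_eq_const_of_norm_periodic (L : PeriodPair) {P : Set ℂ}
    (hP : ∀ z, ∀ᶠ w in 𝓝[≠] z, w ∉ P) (hPper : ∀ γ ∈ L.lattice, ∀ z, z + γ ∈ P ↔ z ∈ P)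
    {t : ℂ → ℂ} (ht : DifferentiableOn ℂ t Pᶜ)
    (hper : ∀ γ ∈ L.lattice, ∀ z ∉ P, ‖t (z + γ)‖ = ‖t z‖)
    (hb : ∀ p ∈ P, ∃ γ ∈ L.lattice, ∃ M : ℝ, ∀ᶠ z in 𝓝[≠] (p + γ), ‖t z‖ ≤ M) :
    ∃ c, (∀ z ∉ P, t z = c) ∧ ∀ p l, Tendsto t (𝓝[≠] p) (𝓝 l) → l = c := by
  obtain ⟨F, hF, hFt⟩ := exists_differentiableOn_extension (U := univ) hP isOpen_univ
    (by rwa [← compl_eq_univ_sdiff]) (fun p hp => by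
      obtain ⟨γ, hγ, M, hM⟩ := hb p hp.2
      refine ⟨M, ?_⟩
      filter_upwards [(tendsto_add_const_nhdsNE p γ).eventually hM, hP p] with z h1 h2
      rwa [hper γ hγ z h2] at h1)
  rw [← compl_eq_univ_sdiff] at hFt
  rw [differentiableOn_univ] at hF
  have hFper : ∀ γ ∈ L.lattice, ∀ z, ‖F (z + γ)‖ = ‖F z‖ := by
    intro γ hγ z
    have h1 : Tendsto (fun w => ‖F (w + γ)‖) (𝓝[≠] z) (𝓝 ‖F (z + γ)‖) :=
      (Continuous.tendsto (hF.continuous.comp (by fun_prop)).norm z).mono_left nhdsWithin_le_nhds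
    have h2 : Tendsto (fun w => ‖F w‖) (𝓝[≠] z) (𝓝 ‖F z‖) :=
      (hF.continuous.norm.tendsto z).mono_left nhdsWithin_le_nhds
    refine tendsto_nhds_unique h1 (h2.congr' ?_)
    filter_upwards [hP z] with w hw
    rw [hFt hw, hFt (fun h => hw ((hPper γ hγ w).1 h)), hper γ hγ w hw]
  have hc := fun z => eq_const_of_norm_periodic L hF hFper z 0
  refine ⟨F 0, fun z hz => by rw [← hFt hz, hc], fun p l hl => tendsto_nhds_unique hl ?_⟩
  refine tendsto_const_nhds.congr' ?_
  filter_upwards [hP p] with w hw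
  rw [← hFt hw]
  exact (hc w).symm

/-! ### Simple poles of the spinors -/

/-- `t` has the Laurent expansion `r / (z - p) + O(z - p)` at `p`: at most a simple pole, with
residue `r` and no constant term. For a spinor the missing constant term says that the square of
the spinor has no residue. -/
def HasOddPole (t : ℂ → ℂ) (p r : ℂ) : Prop :=
  ∃ T : ℂ → ℂ, AnalyticAt ℂ T p ∧ T p = r ∧ deriv T p = 0 ∧
    ∀ᶠ z in 𝓝[≠] p, t z = T z / (z - p)

namespace HasOddPole

variable {t u : ℂ → ℂ} {p r r' : ℂ}

lemma linear_comb (ht : HasOddPole t p r) (hu : HasOddPole u p r') (a b : ℂ) :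
    HasOddPole (fun z => a * t z + b * u z) p (a * r + b * r') := by
  obtain ⟨T, hT, rfl, hT', hTe⟩ := ht
  obtain ⟨S, hS, rfl, hS', hSe⟩ := hu
  refine ⟨fun z => a * T z + b * S z, (analyticAt_const.mul hT).add (analyticAt_const.mul hS),
    rfl, ?_, ?_⟩
  · rw [deriv_fun_add (by fun_prop) (by fun_prop), deriv_const_mul _ (by fun_prop),
      deriv_const_mul _ (by fun_prop), hT', hS']
    simp
  · filter_upwards [hTe, hSe] with z h1 h2
    rw [h1, h2]; ring

lemma tendsto_zero (ht : HasOddPole t p 0) : Tendsto t (𝓝[≠] p) (𝓝 0) := by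
  obtain ⟨T, hT, h0, hT', hTe⟩ := ht
  have h := hT.differentiableAt.hasDerivAt.tendsto_slope
  rw [hT'] at h
  refine h.congr' ?_
  filter_upwards [hTe] with z hz
  rw [hz, slope_def_field, h0, sub_zero]

lemma tendsto_mul (ht : HasOddPole t p r) (hu : HasOddPole u p 0) :
    ∃ l, Tendsto (fun z => t z * u z) (𝓝[≠] p) (𝓝 l) := by
  obtain ⟨T, hT, -, -, hTe⟩ := ht
  obtain ⟨S, hS, h0, hS', hSe⟩ := hu
  -- `S` vanishes to second order at `p`, so that its second divided difference is continuous
  have hd : AnalyticAt ℂ (dslope S p) p := by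
    obtain ⟨q, hq⟩ := hS
    exact ⟨_, hq.has_fpower_series_dslope_fslope⟩
  have h2 := hd.differentiableAt.hasDerivAt.tendsto_slope
  refine ⟨_, ((hT.continuousAt.tendsto.mono_left nhdsWithin_le_nhds).mul h2).congr' ?_⟩
  filter_upwards [hTe, hSe, self_mem_nhdsWithin] with z h1 h2 h3
  have : z - p ≠ 0 := sub_ne_zero.2 h3
  rw [h1, h2, slope_def_field, dslope_of_ne _ h3, dslope_same, hS', slope_def_field, h0]
  field_simp
  ring

lemma tendsto_inv (ht : HasOddPole t p r) (hr : r ≠ 0) :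
    Tendsto (fun z => (t z)⁻¹) (𝓝[≠] p) (𝓝 0) := by
  obtain ⟨T, hT, h0, -, hTe⟩ := ht
  have hT0 : T p ≠ 0 := by rwa [h0]
  have h : ContinuousAt (fun z => (z - p) / T z) p :=
    ContinuousAt.div (by fun_prop) hT.continuousAt hT0
  have h' : Tendsto (fun z => (z - p) / T z) (𝓝[≠] p) (𝓝 0) := by
    simpa using h.tendsto.mono_left nhdsWithin_le_nhds
  refine h'.congr' ?_
  filter_upwards [hTe] with z hz
  rw [hz, inv_div]

lemma eventually_ne (ht : HasOddPole t p r) (hr : r ≠ 0) : ∀ᶠ z in 𝓝[≠] p, t z ≠ 0 := by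
  obtain ⟨T, hT, h0, -, hTe⟩ := ht
  filter_upwards [hTe, mem_nhdsWithin_of_mem_nhds
    (hT.continuousAt.eventually_ne (show T p ≠ 0 by rwa [h0])), self_mem_nhdsWithin] with z h1 h2 h3
  rw [h1]
  exact div_ne_zero h2 (sub_ne_zero.2 h3)

lemma tendsto_add_reflection (ht : HasOddPole t p r) :
    Tendsto (fun z => t z + t (2 * p - z)) (𝓝[≠] p) (𝓝 0) := by
  obtain ⟨T, hT, -, hT', hTe⟩ := ht
  have hrefl : Tendsto (fun z => 2 * p - z) (𝓝[≠] p) (𝓝[≠] p) := by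
    have := tendsto_const_sub_nhdsNE p (2 * p)
    rwa [show 2 * p - p = p by ring] at this
  have h := hT.differentiableAt.hasDerivAt.tendsto_slope
  rw [hT'] at h
  have h2 := h.add (h.comp hrefl)
  rw [add_zero] at h2
  refine h2.congr' ?_
  filter_upwards [hTe, hrefl.eventually hTe, self_mem_nhdsWithin] with z h1 h2 h3
  have e1 : z - p ≠ 0 := sub_ne_zero.2 h3
  have e2 : 2 * p - z - p ≠ 0 := fun h => e1 (by linear_combination -h)
  rw [h1, h2, Function.comp_apply, slope_def_field, slope_def_field]
  have e3 : 2 * p - z - p = -(z - p) := by ring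
  rw [e3, div_neg, div_neg]
  ring

end HasOddPole

/-! ### Spinors with two simple poles on a torus -/

/-- The union of two cosets of the lattice. -/
def twoCosets (L : PeriodPair) (p₁ p₂ : ℂ) : Set ℂ :=
  {z | z - p₁ ∈ L.lattice ∨ z - p₂ ∈ L.lattice}

section TwoCosets

variable {L : PeriodPair} {p₁ p₂ : ℂ}

lemma eventually_sub_notMem_lattice (L : PeriodPair) (p z : ℂ) :
    ∀ᶠ w in 𝓝[≠] z, w - p ∉ L.lattice := by
  have h : ((L.lattice : Set ℂ) \ {z - p})ᶜ ∈ 𝓝 (z - p) :=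
    L.compl_lattice_sdiff_singleton_mem_nhds _
  have h2 : Tendsto (fun w : ℂ => w - p) (𝓝[≠] z) (𝓝 (z - p)) :=
    (Continuous.tendsto (by fun_prop) z).mono_left nhdsWithin_le_nhds
  filter_upwards [h2 h, self_mem_nhdsWithin] with w h3 h4 h5
  exact h3 ⟨h5, fun h6 => h4 (by simpa using h6)⟩

lemma eventually_notMem_twoCosets (z : ℂ) : ∀ᶠ w in 𝓝[≠] z, w ∉ twoCosets L p₁ p₂ := by
  filter_upwards [eventually_sub_notMem_lattice L p₁ z, eventually_sub_notMem_lattice L p₂ z]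
    with w h1 h2 h3
  exact h3.elim h1 h2

lemma add_sub_mem_lattice_iff {γ : ℂ} (hγ : γ ∈ L.lattice) (z p : ℂ) :
    z + γ - p ∈ L.lattice ↔ z - p ∈ L.lattice := by
  rw [show z + γ - p = z - p + γ by ring, Submodule.add_mem_iff_left _ hγ]

lemma add_mem_twoCosets_iff {γ : ℂ} (hγ : γ ∈ L.lattice) (z : ℂ) :
    z + γ ∈ twoCosets L p₁ p₂ ↔ z ∈ twoCosets L p₁ p₂ :=
  or_congr (add_sub_mem_lattice_iff hγ z p₁) (add_sub_mem_lattice_iff hγ z p₂)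

lemma countable_twoCosets : (twoCosets L p₁ p₂).Countable := by
  have hL : (L.lattice : Set ℂ).Countable :=
    countable_of_Lindelof_of_discrete (X := L.lattice)
  refine ((hL.image (· + p₁)).union (hL.image (· + p₂))).mono ?_
  rintro z (h | h)
  · exact Or.inl ⟨_, h, by simp⟩
  · exact Or.inr ⟨_, h, by simp⟩

/-- Liouville's theorem for a function with singularities on two cosets. -/
lemma exists_eq_const_of_tendsto {t : ℂ → ℂ}
    (ht : DifferentiableOn ℂ t (twoCosets L p₁ p₂)ᶜ)
    (hper : ∀ γ ∈ L.lattice, ∀ z ∉ twoCosets L p₁ p₂, ‖t (z + γ)‖ = ‖t z‖)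
    (h₁ : ∃ l, Tendsto t (𝓝[≠] p₁) (𝓝 l)) (h₂ : ∃ l, Tendsto t (𝓝[≠] p₂) (𝓝 l)) :
    ∃ c, (∀ z ∉ twoCosets L p₁ p₂, t z = c) ∧ ∀ p l, Tendsto t (𝓝[≠] p) (𝓝 l) → l = c := by
  obtain ⟨l₁, hl₁⟩ := h₁
  obtain ⟨l₂, hl₂⟩ := h₂
  refine exists_eq_const_of_norm_periodic L eventually_notMem_twoCosets
    (fun γ hγ z => add_mem_twoCosets_iff hγ z) ht hper ?_
  rintro p (hp | hp)
  · refine ⟨p₁ - p, by simpa using neg_mem hp, ?_⟩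
    rw [add_sub_cancel]
    exact exists_eventually_norm_le_of_tendsto hl₁
  · refine ⟨p₂ - p, by simpa using neg_mem hp, ?_⟩
    rw [add_sub_cancel]
    exact exists_eventually_norm_le_of_tendsto hl₂

end TwoCosets

/-- A pair of functions on the complement of two cosets of `Γ`, with monodromy `e`, without common
zeros, and with residue vectors `(a₁, a₂)` and `(b₁, b₂)` at the two poles. -/
structure IsTwoEndedSpinor (L : PeriodPair) (p₁ p₂ : ℂ) (e : L.lattice → ℂ) (s₁ s₂ : ℂ → ℂ)
    (a₁ a₂ b₁ b₂ : ℂ) : Prop where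
  diff₁ : DifferentiableOn ℂ s₁ (twoCosets L p₁ p₂)ᶜ
  diff₂ : DifferentiableOn ℂ s₂ (twoCosets L p₁ p₂)ᶜ
  ne_zero : ∀ z ∉ twoCosets L p₁ p₂, s₁ z ≠ 0 ∨ s₂ z ≠ 0
  sign : ∀ γ, e γ = 1 ∨ e γ = -1
  sign_neg : ∀ γ, e (-γ) = e γ
  monodromy₁ : ∀ (γ : L.lattice), ∀ z ∉ twoCosets L p₁ p₂, s₁ (z + γ) = e γ * s₁ z
  monodromy₂ : ∀ (γ : L.lattice), ∀ z ∉ twoCosets L p₁ p₂, s₂ (z + γ) = e γ * s₂ z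
  pole₁₁ : HasOddPole s₁ p₁ a₁
  pole₂₁ : HasOddPole s₂ p₁ a₂
  pole₁₂ : HasOddPole s₁ p₂ b₁
  pole₂₂ : HasOddPole s₂ p₂ b₂
  residue₁ : a₁ ≠ 0 ∨ a₂ ≠ 0
  residue₂ : b₁ ≠ 0 ∨ b₂ ≠ 0

namespace IsTwoEndedSpinor

variable {L : PeriodPair} {p₁ p₂ : ℂ} {e : L.lattice → ℂ} {s₁ s₂ : ℂ → ℂ} {a₁ a₂ b₁ b₂ : ℂ}

lemma norm_sign (h : IsTwoEndedSpinor L p₁ p₂ e s₁ s₂ a₁ a₂ b₁ b₂) (γ : L.lattice) :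
    ‖e γ‖ = 1 := by
  rcases h.sign γ with h | h <;> simp [h]

lemma differentiableOn_comb (h : IsTwoEndedSpinor L p₁ p₂ e s₁ s₂ a₁ a₂ b₁ b₂) (x y : ℂ) :
    DifferentiableOn ℂ (fun z => x * s₁ z + y * s₂ z) (twoCosets L p₁ p₂)ᶜ :=
  (h.diff₁.const_mul x).add (h.diff₂.const_mul y)

lemma comb_add (h : IsTwoEndedSpinor L p₁ p₂ e s₁ s₂ a₁ a₂ b₁ b₂) (x y : ℂ) (γ : L.lattice)
    {z : ℂ} (hz : z ∉ twoCosets L p₁ p₂) :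
    x * s₁ (z + γ) + y * s₂ (z + γ) = e γ * (x * s₁ z + y * s₂ z) := by
  rw [h.monodromy₁ γ z hz, h.monodromy₂ γ z hz]; ring

/-- The residue vectors at the two poles are linearly independent. Otherwise a nontrivial
combination of `s₁` and `s₂` has no residue at all, hence vanishes by Liouville's theorem; a
complementary combination then has no zeros, and its reciprocal vanishes by Liouville's theorem. -/
lemma residue_det_ne_zero (h : IsTwoEndedSpinor L p₁ p₂ e s₁ s₂ a₁ a₂ b₁ b₂) :
    b₂ * a₁ - b₁ * a₂ ≠ 0 := by
  intro hD
  set P := twoCosets L p₁ p₂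
  obtain ⟨c, hc, hcl⟩ := exists_eq_const_of_tendsto (h.differentiableOn_comb a₂ (-a₁))
    (fun γ hγ z hz => by
      rw [h.comb_add a₂ (-a₁) ⟨γ, hγ⟩ hz, norm_mul, h.norm_sign, one_mul])
    ⟨0, by
      have := h.pole₁₁.linear_comb h.pole₂₁ a₂ (-a₁)
      rw [show a₂ * a₁ + -a₁ * a₂ = 0 by ring] at this
      exact this.tendsto_zero⟩
    ⟨0, by
      have := h.pole₁₂.linear_comb h.pole₂₂ a₂ (-a₁)
      rw [show a₂ * b₁ + -a₁ * b₂ = 0 by linear_combination -hD] at this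
      exact this.tendsto_zero⟩
  have hc0 : c = 0 := by
    refine (hcl p₁ 0 ?_).symm
    have := h.pole₁₁.linear_comb h.pole₂₁ a₂ (-a₁)
    rw [show a₂ * a₁ + -a₁ * a₂ = 0 by ring] at this
    exact this.tendsto_zero
  have hdet : a₁ * star a₁ + a₂ * star a₂ ≠ 0 := by
    have e1 : ∀ w : ℂ, w * star w = ((‖w‖ ^ 2 : ℝ) : ℂ) := fun w => by
      rw [Complex.star_def, Complex.mul_conj, Complex.normSq_eq_norm_sq]
    rw [e1, e1, ← Complex.ofReal_add, Complex.ofReal_ne_zero]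
    rcases h.residue₁ with h | h
    · have := norm_pos_iff.2 h; positivity
    · have := norm_pos_iff.2 h; positivity
  have hlin : ∀ x y : ℂ, a₂ * x + -a₁ * y = 0 → star a₁ * x + star a₂ * y = 0 →
      x = 0 ∧ y = 0 := by
    intro x y h1 h2
    constructor <;> refine (mul_eq_zero.1 ?_).resolve_left hdet
    · linear_combination star a₂ * h1 + a₁ * h2
    · linear_combination -star a₁ * h1 + a₂ * h2
  have hne : ∀ z ∉ P, star a₁ * s₁ z + star a₂ * s₂ z ≠ 0 := by
    intro z hz h0
    obtain ⟨h1, h2⟩ := hlin _ _ ((hc z hz).trans hc0) h0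
    exact (h.ne_zero z hz).elim (· h1) (· h2)
  have hl₁ : Tendsto (fun z => (star a₁ * s₁ z + star a₂ * s₂ z)⁻¹) (𝓝[≠] p₁) (𝓝 0) :=
    (h.pole₁₁.linear_comb h.pole₂₁ (star a₁) (star a₂)).tendsto_inv
      (by intro h0; exact hdet (by linear_combination h0))
  have hl₂ : Tendsto (fun z => (star a₁ * s₁ z + star a₂ * s₂ z)⁻¹) (𝓝[≠] p₂) (𝓝 0) :=
    (h.pole₁₂.linear_comb h.pole₂₂ (star a₁) (star a₂)).tendsto_inv (by
      intro h0
      obtain ⟨h1, h2⟩ := hlin b₁ b₂ (by linear_combination -hD) h0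
      exact h.residue₂.elim (· h1) (· h2))
  obtain ⟨d, hd, hdl⟩ := exists_eq_const_of_tendsto
    ((h.differentiableOn_comb (star a₁) (star a₂)).inv hne)
    (fun γ hγ z hz => by
      simp only [Pi.inv_apply]
      rw [h.comb_add (star a₁) (star a₂) ⟨γ, hγ⟩ hz, norm_inv, norm_mul, h.norm_sign, one_mul,
        norm_inv]) ⟨0, hl₁⟩ ⟨0, hl₂⟩
  obtain ⟨z, hz⟩ := (eventually_notMem_twoCosets (L := L) (p₁ := p₁) (p₂ := p₂) 0).exists
  exact inv_ne_zero (hne z hz) ((hd z hz).trans (hdl p₁ 0 hl₁).symm)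

/-- The combination `t₁` of the spinors with a pole at `p₁` only is nonzero away from `p₁` and
`p₂`: its product with the combination `t₂` with a pole at `p₂` only is a nonzero constant, because
`t₁` vanishes at `p₂` and `t₂` at `p₁`. -/
lemma comb_ne_zero (h : IsTwoEndedSpinor L p₁ p₂ e s₁ s₂ a₁ a₂ b₁ b₂) {z : ℂ}
    (hz : z ∉ twoCosets L p₁ p₂) : b₂ * s₁ z + -b₁ * s₂ z ≠ 0 := by
  have hD := h.residue_det_ne_zero
  set P := twoCosets L p₁ p₂
  have hPo : IsOpen Pᶜ := isOpen_compl_of_eventually_notMem eventually_notMem_twoCosets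
  set t₁ : ℂ → ℂ := fun z => b₂ * s₁ z + -b₁ * s₂ z with ht₁
  set t₂ : ℂ → ℂ := fun z => a₂ * s₁ z + -a₁ * s₂ z with ht₂
  have q₁₁ : HasOddPole t₁ p₁ (b₂ * a₁ + -b₁ * a₂) := h.pole₁₁.linear_comb h.pole₂₁ _ _
  have q₁₂ : HasOddPole t₁ p₂ 0 := by
    have := h.pole₁₂.linear_comb h.pole₂₂ b₂ (-b₁)
    rwa [show b₂ * b₁ + -b₁ * b₂ = 0 by ring] at this
  have q₂₁ : HasOddPole t₂ p₁ 0 := by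
    have := h.pole₁₁.linear_comb h.pole₂₁ a₂ (-a₁)
    rwa [show a₂ * a₁ + -a₁ * a₂ = 0 by ring] at this
  have q₂₂ : HasOddPole t₂ p₂ (a₂ * b₁ + -a₁ * b₂) := h.pole₁₂.linear_comb h.pole₂₂ _ _
  have d₁ : DifferentiableOn ℂ t₁ Pᶜ := h.differentiableOn_comb _ _
  have d₂ : DifferentiableOn ℂ t₂ Pᶜ := h.differentiableOn_comb _ _
  obtain ⟨c, hc, -⟩ := exists_eq_const_of_tendsto (d₁.mul d₂)
    (fun γ hγ z hz => by
      have e1 : t₁ (z + γ) = _ := h.comb_add b₂ (-b₁) ⟨γ, hγ⟩ hz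
      have e2 : t₂ (z + γ) = _ := h.comb_add a₂ (-a₁) ⟨γ, hγ⟩ hz
      simp only [Pi.mul_apply]
      rw [e1, e2, norm_mul, norm_mul, norm_mul, norm_mul, h.norm_sign, one_mul, one_mul])
    (q₁₁.tendsto_mul q₂₁) (by rw [mul_comm t₁ t₂]; exact q₂₂.tendsto_mul q₁₂)
  -- otherwise `t₁` or `t₂` vanishes identically, although each of them has a pole
  have hc0 : c ≠ 0 := by
    rintro rfl
    have hconn : IsPreconnected Pᶜ :=
      (Set.Countable.isConnected_compl_of_one_lt_rank (by simp) countable_twoCosets).isPreconnected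
    rcases (d₁.analyticOnNhd hPo).eq_zero_or_eq_zero_of_mul_eq_zero (d₂.analyticOnNhd hPo) hc hconn
      with h0 | h0
    · obtain ⟨w, h1, h2⟩ := ((q₁₁.eventually_ne (by rwa [neg_mul, ← sub_eq_add_neg])).and
        (eventually_notMem_twoCosets p₁)).exists
      exact h1 (h0 w h2)
    · obtain ⟨w, h1, h2⟩ := ((q₂₂.eventually_ne fun h => hD (by linear_combination -h)).and
        (eventually_notMem_twoCosets p₂)).exists
      exact h1 (h0 w h2)
  intro h0
  have hz' : t₁ z * t₂ z = c := hc z hz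
  rw [show t₁ z = 0 from h0, zero_mul] at hz'
  exact hc0 hz'.symm

/-- A lattice vector `γ ∉ 2Γ` of trivial monodromy determines the position of the second pole:
the spinor `t₁` with a pole at `p₁` only is odd with respect to `p₁`, again by Liouville's theorem.
It therefore changes its sign from `p₁ - γ / 2` to `p₁ + γ / 2`, but also has the same value at
these points. As it has no zeros, `p₁ + γ / 2` must be a pole. -/
theorem half_sub_mem_lattice (h : IsTwoEndedSpinor L p₁ p₂ e s₁ s₂ a₁ a₂ b₁ b₂) (γ : L.lattice)
    (hγ : e γ = 1) (hγ2 : (γ : ℂ) / 2 ∉ L.lattice) : p₁ + γ / 2 - p₂ ∈ L.lattice := by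
  by_contra hq
  set P := twoCosets L p₁ p₂ with hP
  have hPo : IsOpen Pᶜ := isOpen_compl_of_eventually_notMem eventually_notMem_twoCosets
  set t : ℂ → ℂ := fun z => b₂ * s₁ z + -b₁ * s₂ z with ht
  have q₁ : HasOddPole t p₁ (b₂ * a₁ + -b₁ * a₂) := h.pole₁₁.linear_comb h.pole₂₁ _ _
  have q₂ : HasOddPole t p₂ 0 := by
    have := h.pole₁₂.linear_comb h.pole₂₂ b₂ (-b₁)
    rwa [show b₂ * b₁ + -b₁ * b₂ = 0 by ring] at this
  have hd : DifferentiableOn ℂ t Pᶜ := h.differentiableOn_comb _ _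
  have hmon : ∀ (δ : L.lattice), ∀ z ∉ P, t (z + δ) = e δ * t z := fun δ z hz =>
    h.comb_add b₂ (-b₁) δ hz
  -- `t` is bounded near every point outside the coset of `p₁`
  have hbd : ∀ q, q - p₁ ∉ L.lattice → ∃ M : ℝ, ∀ᶠ z in 𝓝[≠] q, ‖t z‖ ≤ M := by
    intro q hq
    by_cases hqP : q ∈ P
    · have hq2 : q - p₂ ∈ L.lattice := hqP.resolve_left hq
      obtain ⟨M, hM⟩ := exists_eventually_norm_le_of_tendsto q₂.tendsto_zero
      refine ⟨M, ?_⟩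
      have hT := tendsto_add_const_nhdsNE q (p₂ - q)
      rw [add_sub_cancel] at hT
      filter_upwards [hT.eventually hM, eventually_notMem_twoCosets q] with z h1 h2
      have h3 := hmon ⟨p₂ - q, by simpa using neg_mem hq2⟩ z h2
      simp only at h3
      rwa [h3, norm_mul, h.norm_sign, one_mul] at h1
    · exact exists_eventually_norm_le_of_tendsto
        ((hd.differentiableAt (hPo.mem_nhds hqP)).continuousAt.tendsto.mono_left nhdsWithin_le_nhds)
  set P' : Set ℂ := {z | z ∈ P ∨ 2 * p₁ - z ∈ P} with hP'
  have hP'd : ∀ z, ∀ᶠ w in 𝓝[≠] z, w ∉ P' := by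
    intro z
    filter_upwards [eventually_notMem_twoCosets z,
      (tendsto_const_sub_nhdsNE z (2 * p₁)).eventually (eventually_notMem_twoCosets _)]
      with w h1 h2 h3
    exact h3.elim h1 h2
  have hsub : ∀ z δ : ℂ, 2 * p₁ - (z + δ) = 2 * p₁ - z + -δ := fun z δ => by ring
  have hP'per : ∀ δ ∈ L.lattice, ∀ z, z + δ ∈ P' ↔ z ∈ P' := fun δ hδ z =>
    or_congr (add_mem_twoCosets_iff hδ z)
      (by rw [hsub]; exact add_mem_twoCosets_iff (neg_mem hδ) _)
  obtain ⟨c, hc, hcl⟩ := exists_eq_const_of_norm_periodic L hP'd hP'per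
    (t := fun z => t z + t (2 * p₁ - z)) (by
      intro z hz
      have hz1 : z ∉ P := fun h => hz (Or.inl h)
      have hz2 : 2 * p₁ - z ∉ P := fun h => hz (Or.inr h)
      refine DifferentiableAt.differentiableWithinAt ?_
      exact (hd.differentiableAt (hPo.mem_nhds hz1)).add
        (DifferentiableAt.comp z (hd.differentiableAt (hPo.mem_nhds hz2)) (by fun_prop)))
    (by
      intro δ hδ z hz
      have e1 := hmon ⟨δ, hδ⟩ z (fun h => hz (Or.inl h))
      have e2 := hmon (-⟨δ, hδ⟩) (2 * p₁ - z) (fun h => hz (Or.inr h))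
      rw [h.sign_neg] at e2
      rw [hsub]
      simp only [NegMemClass.coe_neg] at e1 e2
      rw [e1, e2, ← mul_add, norm_mul, h.norm_sign, one_mul])
    (by
      intro p _
      by_cases hp : p - p₁ ∈ L.lattice
      · refine ⟨p₁ - p, by simpa using neg_mem hp, ?_⟩
        rw [add_sub_cancel]
        exact exists_eventually_norm_le_of_tendsto q₁.tendsto_add_reflection
      · refine ⟨0, zero_mem _, ?_⟩
        rw [add_zero]
        obtain ⟨M, hM⟩ := hbd p hp
        obtain ⟨N, hN⟩ := hbd (2 * p₁ - p) (fun h' => hp (by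
          have := neg_mem h'
          rwa [show -(2 * p₁ - p - p₁) = p - p₁ by ring] at this))
        refine ⟨M + N, ?_⟩
        filter_upwards [hM, (tendsto_const_sub_nhdsNE p (2 * p₁)).eventually hN] with z h1 h2
        exact norm_add_le_of_le h1 h2)
  have hc0 : c = 0 := (hcl p₁ 0 q₁.tendsto_add_reflection).symm
  have hqP : p₁ + γ / 2 ∉ P := by
    rintro (h' | h')
    · exact hγ2 (by simpa using h')
    · exact hq h'
  have hqP2 : p₁ - γ / 2 ∉ P := by
    rw [← add_mem_twoCosets_iff γ.2]
    rwa [show p₁ - γ / 2 + γ = p₁ + (γ : ℂ) / 2 by ring]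
  have hrefl : 2 * p₁ - (p₁ + γ / 2) = p₁ - (γ : ℂ) / 2 := by ring
  have h1 : t (p₁ + γ / 2) + t (p₁ - γ / 2) = 0 := by
    have := hc (p₁ + γ / 2) (by
      rintro (h' | h')
      · exact hqP h'
      · rw [hrefl] at h'; exact hqP2 h')
    rwa [hrefl, hc0] at this
  have h2 : t (p₁ + γ / 2) = t (p₁ - γ / 2) := by
    have := hmon γ _ hqP2
    rwa [show p₁ - γ / 2 + γ = p₁ + (γ : ℂ) / 2 by ring, hγ, one_mul] at this
  exact h.comb_ne_zero hqP (show t (p₁ + γ / 2) = 0 by linear_combination (h1 + h2) / 2)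

end IsTwoEndedSpinor

/-! ### The holomorphic null curve of a conformal minimal surface -/

/-- The `k`-th component of `g_x - i g_y = 2 ∂g/∂z`. -/
def nullCurve (g : ℂ → E3) (k : Fin 3) (z : ℂ) : ℂ := (dX g z k : ℂ) - I * (dY g z k : ℂ)

/-- The function which the Weierstrass representation identifies with `s₁²`. -/
def formA (g : ℂ → E3) (z : ℂ) : ℂ := (nullCurve g 1 z - I * nullCurve g 2 z) / 2

/-- The function which the Weierstrass representation identifies with `s₁ s₂`. -/
def formB (g : ℂ → E3) (z : ℂ) : ℂ := nullCurve g 0 z / 2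

/-- The function which the Weierstrass representation identifies with `s₂²`. -/
def formC (g : ℂ → E3) (z : ℂ) : ℂ := (-nullCurve g 1 z - I * nullCurve g 2 z) / 2

lemma fderiv_apply_eq_re (g : ℂ → E3) (z v : ℂ) (k : Fin 3) :
    fderiv ℝ g z v k = (nullCurve g k z * v).re := by
  have hv : v = v.re • (1 : ℂ) + v.im • I := by simp
  conv_lhs => rw [hv, map_add, map_smul, map_smul]
  simp [nullCurve, dX, dY]
  ring

section Conformal

variable {g : ℂ → E3} {z : ℂ}

lemma inner_partials_of_conformalAt (h : ConformalAt g z) :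
    0 < ⟪dX g z, dX g z⟫ ∧ ⟪dY g z, dY g z⟫ = ⟪dX g z, dX g z⟫ ∧ ⟪dX g z, dY g z⟫ = 0 := by
  obtain ⟨c, hc, h⟩ := conformalAt_iff'.1 h
  simp only [dX, dY, h]
  simp [hc]

/-- A vector orthogonal to `a`, `b` and `a × b` vanishes if `a` and `b` are orthogonal and of the
same nonzero length. -/
lemma eq_zero_of_inner_cross_eq_zero {h a b : E3} (haa : 0 < ⟪a, a⟫) (hbb : ⟪b, b⟫ = ⟪a, a⟫)
    (hab : ⟪a, b⟫ = 0) (ha : ⟪h, a⟫ = 0) (hb : ⟪h, b⟫ = 0)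
    (hc : ⟪h, (‖(WithLp.toLp 2 (a.ofLp ⨯₃ b.ofLp) : E3)‖⁻¹ •
      (WithLp.toLp 2 (a.ofLp ⨯₃ b.ofLp) : E3))⟫ = 0) : h = 0 := by
  set c : E3 := WithLp.toLp 2 (a.ofLp ⨯₃ b.ofLp) with hcdef
  have c0 : c 0 = a 1 * b 2 - a 2 * b 1 := by simp [hcdef, crossProduct]
  have c1 : c 1 = a 2 * b 0 - a 0 * b 2 := by simp [hcdef, crossProduct]
  have c2 : c 2 = a 0 * b 1 - a 1 * b 0 := by simp [hcdef, crossProduct]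
  have e : ∀ u v : E3, ⟪u, v⟫ = u 0 * v 0 + u 1 * v 1 + u 2 * v 2 := fun u v => by
    simp [PiLp.inner_apply, Fin.sum_univ_three, mul_comm]
  have hcc : ⟪c, c⟫ = ⟪a, a⟫ * ⟪b, b⟫ - ⟪a, b⟫ ^ 2 := by
    simp only [e, c0, c1, c2]; ring
  have hcpos : 0 < ⟪c, c⟫ := by
    rw [hcc, hbb, hab]; nlinarith
  have hcne : ‖c‖ ≠ 0 := by
    rw [real_inner_self_eq_norm_sq] at hcpos
    intro h0; rw [h0] at hcpos; norm_num at hcpos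
  rw [inner_smul_right, mul_eq_zero, or_iff_right (inv_ne_zero hcne)] at hc
  -- Lagrange's identity for `h` and `a × b`, with the vector triple product expanded
  have hl : ⟪h, h⟫ * ⟪c, c⟫ = ⟪h, c⟫ ^ 2 + (⟪h, b⟫ ^ 2 * ⟪a, a⟫ - 2 * ⟪h, a⟫ * ⟪h, b⟫ * ⟪a, b⟫
      + ⟪h, a⟫ ^ 2 * ⟪b, b⟫) := by
    simp only [e, c0, c1, c2]; ring
  rw [hc, ha, hb] at hl
  have : ⟪h, h⟫ = 0 := (mul_eq_zero.1 (by linarith)).resolve_right hcpos.ne'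
  exact inner_self_eq_zero.1 this

/-- A conformal surface of vanishing mean curvature is harmonic. Conformality makes the Laplacian
normal, and the mean curvature is its normal component up to the conformal factor. -/
lemma laplacian_eq_zero (hg : ContDiffAt ℝ ∞ g z) (hc : ∀ᶠ w in 𝓝 z, ConformalAt g w)
    (hH : meanCurvature g z = 0) :
    dX (dX g) z + dY (dY g) z = 0 ∧ dX (dY g) z = dY (dX g) z ∧
      DifferentiableAt ℝ (dX g) z ∧ DifferentiableAt ℝ (dY g) z := by
  have hD : DifferentiableAt ℝ (fderiv ℝ g) z :=
    (hg.fderiv_right (m := 1) (WithTop.coe_le_coe.2 le_top)).differentiableAt one_ne_zero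
  have hX : DifferentiableAt ℝ (dX g) z := by unfold dX; fun_prop
  have hY : DifferentiableAt ℝ (dY g) z := by unfold dY; fun_prop
  have hsymm : dX (dY g) z = dY (dX g) z := by
    have h2 : ContDiffAt ℝ 2 g z := hg.of_le ENat.LEInfty.out
    have hs := h2.isSymmSndFDerivAt (by simp) 1 I
    unfold dX dY
    rw [fderiv_clm_apply hD (by fun_prop), fderiv_clm_apply hD (by fun_prop)]
    simpa using hs
  have hev := hc.mono fun w => inner_partials_of_conformalAt
  obtain ⟨haa, hbb, hab⟩ := hev.self_of_nhds
  have k1 : ∀ v, fderiv ℝ (fun w => ⟪dY g w, dY g w⟫) z v =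
      fderiv ℝ (fun w => ⟪dX g w, dX g w⟫) z v := fun v => by
    rw [Filter.EventuallyEq.fderiv_eq (hev.mono fun w h => h.2.1)]
  have k2 : ∀ v, fderiv ℝ (fun w => ⟪dX g w, dY g w⟫) z v = 0 := fun v => by
    rw [Filter.EventuallyEq.fderiv_eq (f := fun _ => (0 : ℝ)) (hev.mono fun w h => h.2.2)]
    simp
  simp only [fderiv_inner_apply ℝ hX hX, fderiv_inner_apply ℝ hY hY] at k1
  simp only [fderiv_inner_apply ℝ hX hY] at k2
  have k1x := k1 1
  have k1y := k1 I
  have k2x := k2 1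
  have k2y := k2 I
  change ⟪_, dX (dY g) z⟫ + ⟪dX (dY g) z, _⟫ = ⟪_, dX (dX g) z⟫ + ⟪dX (dX g) z, _⟫ at k1x
  change ⟪_, dY (dY g) z⟫ + ⟪dY (dY g) z, _⟫ = ⟪_, dY (dX g) z⟫ + ⟪dY (dX g) z, _⟫ at k1y
  change ⟪_, dX (dY g) z⟫ + ⟪dX (dX g) z, _⟫ = 0 at k2x
  change ⟪_, dY (dY g) z⟫ + ⟪dY (dX g) z, _⟫ = 0 at k2y
  rw [hsymm] at k1x k2x
  have c1 := real_inner_comm (dY g z) (dY (dX g) z)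
  have c2 := real_inner_comm (dX g z) (dX (dX g) z)
  have c3 := real_inner_comm (dY g z) (dY (dY g) z)
  have c4 := real_inner_comm (dX g z) (dY (dX g) z)
  have c5 := real_inner_comm (dX g z) (dY (dY g) z)
  refine ⟨eq_zero_of_inner_cross_eq_zero haa hbb hab ?_ ?_ ?_, hsymm, hX, hY⟩
  · rw [inner_add_left]; linarith
  · rw [inner_add_left]; linarith
  · have hH' : (⟪dX (dX g) z, unitNormal g z⟫ * ⟪dY g z, dY g z⟫
        - 2 * ⟪dX (dY g) z, unitNormal g z⟫ * ⟪dX g z, dY g z⟫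
        + ⟪dY (dY g) z, unitNormal g z⟫ * ⟪dX g z, dX g z⟫) /
        (2 * (⟪dX g z, dX g z⟫ * ⟪dY g z, dY g z⟫ - ⟪dX g z, dY g z⟫ ^ 2)) = 0 := hH
    rw [hbb, hab, div_eq_zero_iff] at hH'
    rcases hH' with h | h
    · have h2 : (⟪dX (dX g) z, unitNormal g z⟫ + ⟪dY (dY g) z, unitNormal g z⟫)
          * ⟪dX g z, dX g z⟫ = 0 := by linarith
      change ⟪_, unitNormal g z⟫ = 0
      rw [inner_add_left]
      exact (mul_eq_zero.1 h2).resolve_right haa.ne'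
    · nlinarith

/-- The Cauchy-Riemann equations for `g_x - i g_y`. -/
lemma differentiableAt_nullCurve (hg : ContDiffAt ℝ ∞ g z) (hc : ∀ᶠ w in 𝓝 z, ConformalAt g w)
    (hH : meanCurvature g z = 0) (k : Fin 3) : DifferentiableAt ℂ (nullCurve g k) z := by
  obtain ⟨hl, hs, hX, hY⟩ := laplacian_eq_zero hg hc hH
  have pX : HasFDerivAt (fun w => ((dX g w k : ℝ) : ℂ))
      (ofRealCLM.comp ((EuclideanSpace.proj k : E3 →L[ℝ] ℝ).comp (fderiv ℝ (dX g) z))) z :=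
    ofRealCLM.hasFDerivAt.comp z
      ((EuclideanSpace.proj k : E3 →L[ℝ] ℝ).hasFDerivAt.comp z hX.hasFDerivAt)
  have pY : HasFDerivAt (fun w => ((dY g w k : ℝ) : ℂ))
      (ofRealCLM.comp ((EuclideanSpace.proj k : E3 →L[ℝ] ℝ).comp (fderiv ℝ (dY g) z))) z :=
    ofRealCLM.hasFDerivAt.comp z
      ((EuclideanSpace.proj k : E3 →L[ℝ] ℝ).hasFDerivAt.comp z hY.hasFDerivAt)
  have hΦ : HasFDerivAt (nullCurve g k) _ z := pX.sub (pY.const_mul I)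
  rw [differentiableAt_complex_iff_differentiableAt_real]
  refine ⟨hΦ.differentiableAt, ?_⟩
  rw [hΦ.fderiv]
  have e1 : fderiv ℝ (dX g) z I = fderiv ℝ (dY g) z 1 := hs.symm
  have e2 : fderiv ℝ (dX g) z 1 = -fderiv ℝ (dY g) z I := eq_neg_of_add_eq_zero_left hl
  simp [e1, e2]
  ring_nf
  simp

lemma formB_sq (h : ConformalAt g z) : formB g z ^ 2 = formA g z * formC g z := by
  obtain ⟨-, hbb, hab⟩ := inner_partials_of_conformalAt h
  simp only [PiLp.inner_apply, Fin.sum_univ_three, RCLike.inner_apply, conj_trivial] at hbb hab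
  have h1 : ((dY g z 0 * dY g z 0 + dY g z 1 * dY g z 1 + dY g z 2 * dY g z 2 : ℝ) : ℂ) =
    ((dX g z 0 * dX g z 0 + dX g z 1 * dX g z 1 + dX g z 2 * dX g z 2 : ℝ) : ℂ) := by rw [hbb]
  have h2 : ((dY g z 0 * dX g z 0 + dY g z 1 * dX g z 1 + dY g z 2 * dX g z 2 : ℝ) : ℂ) = 0 := by
    rw [hab]; simp
  push_cast at h1 h2
  have hI := Complex.I_sq
  have hN : nullCurve g 0 z ^ 2 + nullCurve g 1 z ^ 2 + nullCurve g 2 z ^ 2 = 0 := by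
    unfold nullCurve
    linear_combination -h1 - 2 * I * h2 +
      ((dY g z 0 : ℂ) ^ 2 + (dY g z 1 : ℂ) ^ 2 + (dY g z 2 : ℂ) ^ 2) * hI
  unfold formA formB formC
  linear_combination hN / 4 - nullCurve g 2 z ^ 2 * hI / 4

lemma nullCurve_norm_ge (g : ℂ → E3) (z : ℂ) :
    ‖dX g z‖ ≤ ‖nullCurve g 0 z‖ + ‖nullCurve g 1 z‖ + ‖nullCurve g 2 z‖ := by
  have h1 : ∀ k, |dX g z k| ≤ ‖nullCurve g k z‖ := fun k => by
    have := Complex.abs_re_le_norm (nullCurve g k z)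
    simpa [nullCurve] using this
  rw [EuclideanSpace.norm_eq, Fin.sum_univ_three]
  have := h1 0
  have := h1 1
  have := h1 2
  refine Real.sqrt_le_iff.2 ⟨by positivity, ?_⟩
  have a0 := abs_nonneg (dX g z 0)
  have a1 := abs_nonneg (dX g z 1)
  have a2 := abs_nonneg (dX g z 2)
  simp only [Real.norm_eq_abs]
  nlinarith [mul_nonneg a0 a1, mul_nonneg a0 a2, mul_nonneg a1 a2]

lemma nullCurve_norm_le (g : ℂ → E3) (z : ℂ) (k : Fin 3) :
    ‖nullCurve g k z‖ ≤ ‖dX g z‖ + ‖dY g z‖ := by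
  unfold nullCurve
  refine (norm_sub_le _ _).trans (add_le_add ?_ ?_)
  · simpa using PiLp.norm_apply_le (dX g z) k
  · simpa using PiLp.norm_apply_le (dY g z) k

lemma formA_ne_zero_or_formC_ne_zero (h : ConformalAt g z) : formA g z ≠ 0 ∨ formC g z ≠ 0 := by
  by_contra! hAC
  obtain ⟨hA, hC⟩ := hAC
  have hB : formB g z = 0 := by
    have := formB_sq h
    rw [hA, zero_mul] at this
    exact pow_eq_zero_iff two_ne_zero |>.1 this
  have h0 : nullCurve g 0 z = 0 := by unfold formB at hB; simpa using hB
  have h1 : nullCurve g 1 z = 0 := by unfold formA formC at *; linear_combination hA - hC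
  have h2 : nullCurve g 2 z = 0 := by
    unfold formA formC at *
    have : I * nullCurve g 2 z = 0 := by linear_combination -hA - hC
    simpa using this
  have hn := nullCurve_norm_ge g z
  rw [h0, h1, h2] at hn
  have hp := (inner_partials_of_conformalAt h).1
  rw [real_inner_self_eq_norm_sq] at hp
  have : ‖dX g z‖ = 0 := le_antisymm (by simpa using hn) (norm_nonneg _)
  rw [this] at hp
  norm_num at hp

end Conformal

/-! ### Planar ends -/

/-- A bounded function on `(0, δ)` has no logarithmic growth at `0`. -/
lemma eq_zero_of_tendsto_mul_deriv {u u' : ℝ → ℝ} {l M : ℝ}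
    (hu : ∀ᶠ r in 𝓝[>] 0, HasDerivAt u (u' r) r) (hM : ∀ᶠ r in 𝓝[>] 0, |u r| ≤ M)
    (hl : Tendsto (fun r => r * u' r) (𝓝[>] 0) (𝓝 l)) : l = 0 := by
  have main : ∀ {u u' : ℝ → ℝ} {l : ℝ}, (∀ᶠ r in 𝓝[>] 0, HasDerivAt u (u' r) r) →
      (∀ᶠ r in 𝓝[>] 0, |u r| ≤ M) → Tendsto (fun r => r * u' r) (𝓝[>] 0) (𝓝 l) → l ≤ 0 := by
    intro u u' l hu hM hl
    by_contra! hpos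
    have hev := hu.and (hM.and (hl.eventually_const_lt (half_lt_self hpos)))
    obtain ⟨δ, hδ, hsub⟩ := mem_nhdsGT_iff_exists_Ioo_subset.1 hev
    have hδ' : (0 : ℝ) < δ := hδ
    have hmono : MonotoneOn (fun r => u r - l / 2 * Real.log r) (Ioo 0 δ) := by
      have hd : ∀ r ∈ Ioo 0 δ, HasDerivAt (fun r => u r - l / 2 * Real.log r)
          (u' r - l / 2 * r⁻¹) r := fun r hr =>
        (hsub hr).1.sub ((Real.hasDerivAt_log hr.1.ne').const_mul _)
      refine monotoneOn_of_deriv_nonneg (convex_Ioo 0 δ)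
        (fun r hr => (hd r hr).continuousAt.continuousWithinAt)
        (fun r hr => (hd r (interior_subset hr)).differentiableAt.differentiableWithinAt) ?_
      intro r hr
      rw [interior_Ioo] at hr
      rw [(hd r hr).deriv]
      have h1 : l / 2 < r * u' r := (hsub hr).2.2
      have h2 : l / 2 * r⁻¹ < u' r := by
        rw [← div_eq_mul_inv, div_lt_iff₀ hr.1]; linarith
      linarith
    -- at this radius the logarithm has dropped by more than `4 M / l`
    set r₀ := δ / 2 with hr₀
    have hr₀m : r₀ ∈ Ioo 0 δ := ⟨by positivity, by linarith⟩
    have hM0 : 0 ≤ M := (abs_nonneg _).trans (hsub hr₀m).2.1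
    set k : ℝ := (4 * M + 1) / l with hk
    have hkpos : 0 < k := by positivity
    set r := r₀ * Real.exp (-k) with hr
    have hrlt : r ≤ r₀ := by
      have : Real.exp (-k) ≤ 1 := Real.exp_le_one_iff.2 (by linarith)
      nlinarith [hr₀m.1]
    have hrm : r ∈ Ioo 0 δ := ⟨mul_pos hr₀m.1 (Real.exp_pos _), hrlt.trans_lt hr₀m.2⟩
    have h := hmono hrm hr₀m hrlt
    simp only at h
    have hlog : Real.log r = Real.log r₀ - k := by
      rw [hr, Real.log_mul hr₀m.1.ne' (Real.exp_pos _).ne', Real.log_exp]; ring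
    rw [hlog] at h
    have h1 := abs_le.1 (hsub hrm).2.1
    have h2 := abs_le.1 (hsub hr₀m).2.1
    have h3 : l / 2 * k = (4 * M + 1) / 2 := by rw [hk]; field_simp
    nlinarith
  refine le_antisymm (main hu hM hl) ?_
  have := main (u := fun r => -u r) (u' := fun r => -u' r) (l := -l) (hu.mono fun r h => h.neg)
    (by simpa only [abs_neg] using hM) (by simpa only [mul_neg] using hl.neg)
  linarith

section End

variable {y g : ℂ → E3} {p : ℂ}

/-- Second order Taylor estimates of a conformal map `y` at a point where it vanishes. -/
lemma exists_conformal_estimates (hy0 : y p = 0) (hy : ContDiffAt ℝ ∞ y p)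
    (hyc : ConformalAt y p) :
    ∃ κ > 0, ∃ K : ℝ, ∀ᶠ z in 𝓝 p, DifferentiableAt ℝ y z ∧
      (∀ v, κ / 2 * ‖v‖ ≤ ‖fderiv ℝ y z v‖ ∧ ‖fderiv ℝ y z v‖ ≤ 2 * κ * ‖v‖) ∧
      κ / 2 * ‖z - p‖ ≤ ‖y z‖ ∧ ‖y z‖ ≤ 2 * κ * ‖z - p‖ ∧
      ‖y z - fderiv ℝ y p (z - p)‖ ≤ K * ‖z - p‖ ^ 2 := by
  obtain ⟨c, hc, hcv⟩ := conformalAt_iff'.1 hyc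
  set κ := √c with hκ
  have hκ0 : 0 < κ := Real.sqrt_pos.2 hc
  set D := fderiv ℝ y p with hD
  have hT : ∀ v, ‖D v‖ = κ * ‖v‖ := by
    intro v
    have := hcv v v
    rw [real_inner_self_eq_norm_sq, real_inner_self_eq_norm_sq] at this
    rw [← Real.sqrt_sq (norm_nonneg (D v)), this, Real.sqrt_mul hc.le,
      Real.sqrt_sq (norm_nonneg v)]
  have hdiff : ∀ᶠ z in 𝓝 p, DifferentiableAt ℝ y z := by
    have : ∀ᶠ z in 𝓝 p, ContDiffAt ℝ 1 y z :=
      (hy.of_le (WithTop.coe_le_coe.2 le_top)).eventually (by simp)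
    exact this.mono fun z hz => hz.differentiableAt one_ne_zero
  have hlip : ContDiffAt ℝ 1 (fderiv ℝ y) p := hy.fderiv_right (WithTop.coe_le_coe.2 le_top)
  obtain ⟨K, s, hs, hK⟩ := hlip.exists_lipschitzOnWith
  have hKz : ∀ᶠ z in 𝓝 p, ‖fderiv ℝ y z - D‖ ≤ K * ‖z - p‖ := by
    filter_upwards [hs] with z hz
    simpa [dist_eq_norm] using hK.dist_le_mul z hz p (mem_of_mem_nhds hs)
  obtain ⟨ρ, hρ, hball⟩ := Metric.eventually_nhds_iff_ball.1 (hdiff.and hKz)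
  have htaylor : ∀ z ∈ ball p ρ, ‖y z - D (z - p)‖ ≤ K * ‖z - p‖ ^ 2 := by
    intro z hz
    have hsub : closedBall p ‖z - p‖ ⊆ ball p ρ := closedBall_subset_ball (by
      rwa [← dist_eq_norm])
    have := (convex_closedBall p ‖z - p‖).norm_image_sub_le_of_norm_fderiv_le' (𝕜 := ℝ) (f := y)
      (φ := D) (C := K * ‖z - p‖) (x := p) (y := z) (fun w hw => (hball w (hsub hw)).1)
      (fun w hw => ((hball w (hsub hw)).2).trans (by
        have : ‖w - p‖ ≤ ‖z - p‖ := by simpa [dist_eq_norm] using hw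
        gcongr))
      (mem_closedBall_self (norm_nonneg _)) (by simp [dist_eq_norm])
    rw [hy0, sub_zero] at this
    nlinarith
  have hsmall : ∀ᶠ z in 𝓝 p, K * ‖z - p‖ ≤ κ / 2 := by
    have : Tendsto (fun z : ℂ => K * ‖z - p‖) (𝓝 p) (𝓝 (K * ‖p - p‖)) :=
      Continuous.tendsto (by fun_prop) p
    rw [sub_self, norm_zero, mul_zero] at this
    exact (this.eventually_lt_const (half_pos hκ0)).mono fun _ => le_of_lt
  refine ⟨κ, hκ0, K, ?_⟩
  filter_upwards [ball_mem_nhds p hρ, hsmall] with z hz hz2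
  have h1 := htaylor z hz
  have h2 : ‖y z - D (z - p)‖ ≤ κ / 2 * ‖z - p‖ :=
    h1.trans (by have := mul_le_mul_of_nonneg_right hz2 (norm_nonneg (z - p)); linarith)
  refine ⟨(hball z hz).1, fun v => ?_, ?_, ?_, h1⟩
  · have h3 : ‖fderiv ℝ y z v - D v‖ ≤ κ / 2 * ‖v‖ :=
      ((fderiv ℝ y z - D).le_opNorm v).trans
        (mul_le_mul_of_nonneg_right ((hball z hz).2.trans hz2) (norm_nonneg v))
    have h4 := hT v
    have h5 := norm_sub_norm_le (D v) (fderiv ℝ y z v)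
    rw [norm_sub_rev] at h5
    have h6 := norm_sub_norm_le (fderiv ℝ y z v) (D v)
    constructor <;> nlinarith [norm_nonneg v, mul_nonneg hκ0.le (norm_nonneg v)]
  · have h4 := hT (z - p)
    have h5 := norm_sub_norm_le (D (z - p)) (y z)
    rw [norm_sub_rev] at h5
    nlinarith
  · have h4 := hT (z - p)
    have h5 := norm_sub_norm_le (y z) (D (z - p))
    nlinarith [mul_nonneg hκ0.le (norm_nonneg (z - p))]

lemma eventually_ne_zero_of_conformalAt (hy0 : y p = 0) (hy : ContDiffAt ℝ ∞ y p)
    (hyc : ConformalAt y p) : ∀ᶠ z in 𝓝[≠] p, y z ≠ 0 := by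
  obtain ⟨κ, hκ, K, hest⟩ := exists_conformal_estimates hy0 hy hyc
  filter_upwards [mem_nhdsWithin_of_mem_nhds hest, self_mem_nhdsWithin] with z h1 h2 h3
  have h4 := h1.2.2.1
  rw [h3, norm_zero] at h4
  have : 0 < ‖z - p‖ := norm_pos_iff.2 (sub_ne_zero.2 h2)
  nlinarith

lemma norm_fderiv_inversion_comp {z : ℂ} (hy : DifferentiableAt ℝ y z) (h0 : y z ≠ 0)
    (hg : g =ᶠ[𝓝 z] EuclideanGeometry.inversion (0 : E3) 1 ∘ y) :
    DifferentiableAt ℝ g z ∧ ∀ v, ‖fderiv ℝ g z v‖ = ‖fderiv ℝ y z v‖ / ‖y z‖ ^ 2 := by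
  have h := ((EuclideanGeometry.hasFDerivAt_inversion (R := 1) h0).comp z
    hy.hasFDerivAt).congr_of_eventuallyEq hg
  refine ⟨h.differentiableAt, fun v => ?_⟩
  rw [h.fderiv]
  simp [norm_smul]
  ring

end End

lemma tendsto_add_ofReal_nhdsNE (p : ℂ) :
    Tendsto (fun r : ℝ => p + r) (𝓝[>] 0) (𝓝[≠] p) := by
  refine tendsto_nhdsWithin_of_tendsto_nhds_of_eventually_within _ ?_ ?_
  · have : Tendsto (fun r : ℝ => p + r) (𝓝 0) (𝓝 (p + (0 : ℝ))) :=
      Continuous.tendsto (by fun_prop) 0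
    simpa using this.mono_left nhdsWithin_le_nhds
  · filter_upwards [self_mem_nhdsWithin] with r hr
    simpa using (ne_of_gt hr : r ≠ 0)

lemma tendsto_sub_ofReal_nhdsNE (p : ℂ) :
    Tendsto (fun r : ℝ => p - r) (𝓝[>] 0) (𝓝[≠] p) := by
  have h := (tendsto_const_sub_nhdsNE p (2 * p)).comp (tendsto_add_ofReal_nhdsNE p)
  rw [show 2 * p - p = p by ring] at h
  exact h.congr fun r => by simp only [Function.comp_apply]; ring

section Residue

variable {G : ℂ → ℝ} {Ψ : ℂ → ℂ} {p : ℂ}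

/-- If `dG = Re (Ψ(z) / (z - p)² dz)` for a single-valued function `G`, then the residue `Ψ'(p)` is
real: `2 π i Ψ'(p)` is a period of the form on the right. -/
lemma im_deriv_eq_zero (hΨ : AnalyticAt ℂ Ψ p)
    (hG : ∀ᶠ z in 𝓝[≠] p, DifferentiableAt ℝ G z ∧
      ∀ v, fderiv ℝ G z v = (Ψ z / (z - p) ^ 2 * v).re) : (deriv Ψ p).im = 0 := by
  obtain ⟨ρ, hρ, hball⟩ := Metric.eventually_nhds_iff_ball.1
    ((eventually_nhdsWithin_iff.1 hG).and hΨ.eventually_analyticAt)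
  set R := ρ / 2 with hR
  have hR0 : 0 < R := by positivity
  have hRne : ∀ θ, circleMap p R θ ≠ p := fun θ => circleMap_ne_center hR0.ne'
  have hRmem : ∀ θ, circleMap p R θ ∈ ball p ρ := fun θ =>
    closedBall_subset_ball (by linarith : R < ρ) (circleMap_mem_closedBall p hR0.le θ)
  have hd : ∀ θ : ℝ, HasDerivAt (fun θ => G (circleMap p R θ))
      ((deriv (circleMap p R) θ • (((circleMap p R θ - p) ^ 2)⁻¹ • Ψ (circleMap p R θ))).re) θ := by
    intro θ
    obtain ⟨h1, h2⟩ := (hball _ (hRmem θ)).1 (hRne θ)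
    have h := h1.hasFDerivAt.comp_hasDerivAt θ (hasDerivAt_circleMap p R θ)
    rw [h2] at h
    refine h.congr_deriv ?_
    rw [deriv_circleMap, smul_eq_mul, smul_eq_mul]
    congr 1
    ring
  have hcont : Continuous fun θ : ℝ =>
      deriv (circleMap p R) θ • (((circleMap p R θ - p) ^ 2)⁻¹ • Ψ (circleMap p R θ)) := by
    have hc : Continuous (circleMap p R) := continuous_circleMap p R
    have h1 : Continuous (deriv (circleMap p R)) := by
      have : deriv (circleMap p R) = fun θ => circleMap 0 R θ * I := by
        ext θ; exact deriv_circleMap p R θ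
      rw [this]
      exact (continuous_circleMap 0 R).mul continuous_const
    have h2 : Continuous fun θ : ℝ => Ψ (circleMap p R θ) :=
      continuous_iff_continuousAt.2 fun θ =>
        (hball _ (hRmem θ)).2.continuousAt.comp hc.continuousAt
    exact h1.smul ((((hc.sub continuous_const).pow 2).inv₀
      fun θ => pow_ne_zero _ (sub_ne_zero.2 (hRne θ))).smul h2)
  have hint := intervalIntegral.integral_eq_sub_of_hasDerivAt (a := 0) (b := 2 * Real.pi)
    (fun θ _ => hd θ) ((Complex.continuous_re.comp hcont).intervalIntegrable _ _)
  have hperiod : G (circleMap p R (2 * Real.pi)) - G (circleMap p R 0) = 0 := by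
    rw [sub_eq_zero]
    congr 1
    simpa using periodic_circleMap p R 0
  have hre : (∮ z in C(p, R), ((z - p) ^ 2)⁻¹ • Ψ z).re = 0 := by
    rw [← hperiod, ← hint, circleIntegral]
    exact (Complex.reCLM.intervalIntegral_comp_comm (hcont.intervalIntegrable _ _)).symm
  have hcauchy := two_pi_I_inv_smul_circleIntegral_sub_sq_inv_smul_of_differentiable
    (isOpen_ball (x := p) (ε := ρ)) (closedBall_subset_ball (by linarith : R < ρ))
    (fun z hz => (hball z hz).2.differentiableAt.differentiableWithinAt) (mem_ball_self hR0)
  have hI : (2 * Real.pi * I : ℂ) ≠ 0 := Complex.two_pi_I_ne_zero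
  rw [inv_smul_eq_iff₀ hI] at hcauchy
  rw [hcauchy] at hre
  have h2 : -(2 * Real.pi * (deriv Ψ p).im) = 0 := by simpa using hre
  simpa [Real.pi_ne_zero] using h2

/-- If `dG = Re (Ψ(z) / (z - p)² dz)` and the part of `G` that is even with respect to `p` is
bounded, then the residue `Ψ'(p)` has no real part, which would cause logarithmic growth. -/
lemma re_deriv_eq_zero (hΨ : AnalyticAt ℂ Ψ p)
    (hG : ∀ᶠ z in 𝓝[≠] p, DifferentiableAt ℝ G z ∧
      ∀ v, fderiv ℝ G z v = (Ψ z / (z - p) ^ 2 * v).re)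
    {M : ℝ} (hM : ∀ᶠ r : ℝ in 𝓝[>] 0, |G (p + r) + G (p - r)| ≤ M) : (deriv Ψ p).re = 0 := by
  have hofReal : ∀ r : ℝ, HasDerivAt (fun r : ℝ => (r : ℂ)) 1 r := fun r =>
    Complex.ofRealCLM.hasDerivAt
  have hu : ∀ᶠ r : ℝ in 𝓝[>] 0, HasDerivAt (fun r : ℝ => G (p + r) + G (p - r))
      ((Ψ (p + r) / (r : ℂ) ^ 2 - Ψ (p - r) / (r : ℂ) ^ 2).re) r := by
    filter_upwards [(tendsto_add_ofReal_nhdsNE p).eventually hG,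
      (tendsto_sub_ofReal_nhdsNE p).eventually hG] with r h1 h2
    have d1 := h1.1.hasFDerivAt.comp_hasDerivAt r ((hofReal r).const_add p)
    have d2 := h2.1.hasFDerivAt.comp_hasDerivAt r ((hofReal r).const_sub p)
    rw [h1.2] at d1
    rw [h2.2] at d2
    refine (d1.add d2).congr_deriv ?_
    rw [← add_re]
    congr 1
    simp
    ring
  have hs := (hΨ.differentiableAt.hasDerivAt.tendsto_slope.comp (tendsto_add_ofReal_nhdsNE p)).add
    (hΨ.differentiableAt.hasDerivAt.tendsto_slope.comp (tendsto_sub_ofReal_nhdsNE p))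
  have hl := (Complex.continuous_re.tendsto _).comp hs
  have := eq_zero_of_tendsto_mul_deriv hu hM (hl.congr' (by
    filter_upwards [self_mem_nhdsWithin] with r hr
    have hr' : (r : ℂ) ≠ 0 := by exact_mod_cast (ne_of_gt hr)
    simp only [Function.comp_apply, slope_def_field]
    rw [← re_ofReal_mul]
    congr 1
    rw [add_sub_cancel_left, show p - (r : ℂ) - p = -r by ring]
    field_simp
    ring))
  simpa using this

end Residue

section End

variable {y g : ℂ → E3} {p : ℂ}

/-- The null curve of a conformal minimal surface has a double pole without residue at a point
where the surface passes through `∞`, `y` being the surface in the inverted chart. -/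
theorem exists_planar_end_expansion (hy0 : y p = 0) (hy : ContDiffAt ℝ ∞ y p)
    (hyc : ConformalAt y p)
    (hg : ∀ᶠ z in 𝓝[≠] p, g z = EuclideanGeometry.inversion (0 : E3) 1 (y z))
    (hΦ : ∀ k, ∀ᶠ z in 𝓝[≠] p, DifferentiableAt ℂ (nullCurve g k) z) :
    ∃ Ψ : Fin 3 → ℂ → ℂ, (∀ k, AnalyticAt ℂ (Ψ k) p ∧ deriv (Ψ k) p = 0 ∧
      ∀ᶠ z in 𝓝[≠] p, nullCurve g k z = Ψ k z / (z - p) ^ 2) ∧ ∃ k, Ψ k p ≠ 0 := by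
  obtain ⟨κ, hκ, K, hest⟩ := exists_conformal_estimates hy0 hy hyc
  have hy_ne := eventually_ne_zero_of_conformalAt hy0 hy hyc
  have hgd : ∀ᶠ z in 𝓝[≠] p, DifferentiableAt ℝ g z ∧
      ∀ v, ‖fderiv ℝ g z v‖ = ‖fderiv ℝ y z v‖ / ‖y z‖ ^ 2 := by
    filter_upwards [eventually_eventually_nhdsWithin.2 hg, hy_ne,
      mem_nhdsWithin_of_mem_nhds hest, self_mem_nhdsWithin] with z h1 h2 h3 h4
    rw [isOpen_compl_singleton.nhdsWithin_eq h4] at h1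
    exact norm_fderiv_inversion_comp h3.1 h2 h1
  have hbound : ∀ᶠ z in 𝓝[≠] p, ∀ v, ‖v‖ = 1 →
      ‖(z - p) ^ 2‖ * ‖fderiv ℝ g z v‖ ≤ 8 / κ ∧
        1 / (8 * κ) ≤ ‖(z - p) ^ 2‖ * ‖fderiv ℝ g z v‖ := by
    filter_upwards [hgd, mem_nhdsWithin_of_mem_nhds hest, hy_ne, self_mem_nhdsWithin]
      with z h1 h2 h3 h4 v hv
    have hw : 0 < ‖z - p‖ := norm_pos_iff.2 (sub_ne_zero.2 h4)
    have hyz : 0 < ‖y z‖ := norm_pos_iff.2 h3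
    obtain ⟨-, h5, h6, h7, -⟩ := h2
    obtain ⟨h8, h9⟩ := h5 v
    rw [hv, mul_one] at h8 h9
    rw [h1.2, norm_pow, ← mul_div_assoc]
    have e1 : (κ / 2 * ‖z - p‖) ^ 2 ≤ ‖y z‖ ^ 2 := by gcongr
    have e2 : ‖y z‖ ^ 2 ≤ (2 * κ * ‖z - p‖) ^ 2 := by gcongr
    constructor
    · rw [div_le_div_iff₀ (by positivity) hκ]
      have : ‖z - p‖ ^ 2 * ‖fderiv ℝ y z v‖ ≤ ‖z - p‖ ^ 2 * (2 * κ) := by gcongr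
      nlinarith
    · rw [div_le_div_iff₀ (by positivity) (by positivity)]
      have : ‖z - p‖ ^ 2 * (κ / 2) ≤ ‖z - p‖ ^ 2 * ‖fderiv ℝ y z v‖ := by gcongr
      nlinarith
  have hext : ∀ k, ∃ Ψ, AnalyticAt ℂ Ψ p ∧
      Ψ =ᶠ[𝓝[≠] p] fun z => (z - p) ^ 2 * nullCurve g k z := by
    intro k
    refine exists_analyticAt_eventuallyEq (M := 16 / κ) ?_ ?_
    · filter_upwards [hΦ k] with z hz
      fun_prop
    · filter_upwards [hbound] with z hz
      rw [norm_mul]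
      have h1 := (hz 1 (by simp)).1
      have h2 := (hz I (by simp)).1
      have h3 := mul_le_mul_of_nonneg_left (nullCurve_norm_le g z k) (norm_nonneg ((z - p) ^ 2))
      rw [mul_add] at h3
      refine h3.trans ((add_le_add h1 h2).trans (le_of_eq ?_))
      ring
  choose Ψ hΨ hΨe using hext
  have hΨe' : ∀ k, ∀ᶠ z in 𝓝[≠] p, nullCurve g k z = Ψ k z / (z - p) ^ 2 := by
    intro k
    filter_upwards [hΨe k, self_mem_nhdsWithin] with z h1 h2
    rw [h1, mul_div_cancel_left₀ _ (pow_ne_zero 2 (sub_ne_zero.2 h2))]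
  have hG : ∀ k, ∀ᶠ z in 𝓝[≠] p, DifferentiableAt ℝ (fun z => g z k) z ∧
      ∀ v, fderiv ℝ (fun z => g z k) z v = (Ψ k z / (z - p) ^ 2 * v).re := by
    intro k
    filter_upwards [hgd, hΨe' k] with z h1 h2
    have h := (EuclideanSpace.proj k : E3 →L[ℝ] ℝ).hasFDerivAt.comp z h1.1.hasFDerivAt
    refine ⟨h.differentiableAt, fun v => ?_⟩
    have h3 : fderiv ℝ (fun z => g z k) z = _ := h.fderiv
    rw [h3, ← h2, ← fderiv_apply_eq_re]
    rfl
  -- the inversion is odd, so that the even part of `g` stems from the even part of `y`, of order 2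
  have hM : ∀ k, ∀ᶠ r : ℝ in 𝓝[>] 0, |g (p + r) k + g (p - r) k| ≤ 8 * K / κ ^ 2 := by
    intro k
    have h1 := hg.and (hy_ne.and (mem_nhdsWithin_of_mem_nhds hest))
    filter_upwards [(tendsto_add_ofReal_nhdsNE p).eventually h1,
      (tendsto_sub_ofReal_nhdsNE p).eventually h1, self_mem_nhdsWithin] with r hp hm hr
    have hr0 : 0 < r := hr
    obtain ⟨g1, n1, -, -, l1, -, t1⟩ := hp
    obtain ⟨g2, n2, -, -, l2, -, t2⟩ := hm
    have e1 : p + (r : ℂ) - p = r := by ring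
    have e2 : p - (r : ℂ) - p = -r := by ring
    rw [e1] at l1 t1
    rw [e2] at l2 t2
    rw [map_neg] at t2
    rw [norm_neg] at l2 t2
    rw [Complex.norm_of_nonneg hr0.le] at l1 t1 l2 t2
    have hodd : ∀ x : E3, EuclideanGeometry.inversion (0 : E3) 1 (-x) =
        -EuclideanGeometry.inversion (0 : E3) 1 x := fun x => by
      simp [EuclideanGeometry.inversion]
    have hdist := EuclideanGeometry.dist_inversion_inversion n1 (neg_ne_zero.2 n2) 1
    rw [hodd, ← g1, ← g2, dist_zero_right, dist_zero_right, norm_neg, dist_eq_norm,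
      dist_eq_norm, sub_neg_eq_add, sub_neg_eq_add] at hdist
    have hk : |g (p + r) k + g (p - r) k| ≤ ‖g (p + r) + g (p - r)‖ := by
      simpa using PiLp.norm_apply_le (g (p + r) + g (p - r)) k
    refine hk.trans (hdist.trans_le ?_)
    have hsum : ‖y (p + r) + y (p - r)‖ ≤ 2 * K * r ^ 2 := by
      have := norm_add_le_of_le t1 t2
      rw [show y (p + r) - fderiv ℝ y p r + (y (p - r) - -fderiv ℝ y p r) =
        y (p + r) + y (p - r) by abel] at this
      linarith
    have hK : 0 ≤ K := nonneg_of_mul_nonneg_left ((norm_nonneg _).trans t1) (by positivity)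
    have hprod : (κ / 2 * r) * (κ / 2 * r) ≤ ‖y (p + r)‖ * ‖y (p - r)‖ := by gcongr
    have hpos : 0 < ‖y (p + r)‖ * ‖y (p - r)‖ :=
      mul_pos (norm_pos_iff.2 n1) (norm_pos_iff.2 n2)
    rw [one_pow, one_div, inv_mul_eq_div, div_le_div_iff₀ hpos (by positivity)]
    nlinarith [mul_le_mul_of_nonneg_left hprod hK, mul_le_mul_of_nonneg_right hsum (sq_nonneg κ)]
  refine ⟨Ψ, fun k => ⟨hΨ k, Complex.ext (re_deriv_eq_zero (hΨ k) (hG k) (hM k))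
    (im_deriv_eq_zero (hΨ k) (hG k)), hΨe' k⟩, ?_⟩
  by_contra! h0
  have hlim : Tendsto (fun z => ‖Ψ 0 z‖ + ‖Ψ 1 z‖ + ‖Ψ 2 z‖) (𝓝[≠] p) (𝓝 0) := by
    have hk : ∀ k, Tendsto (fun z => ‖Ψ k z‖) (𝓝[≠] p) (𝓝 0) := fun k => by
      have := (hΨ k).continuousAt.norm.tendsto.mono_left (nhdsWithin_le_nhds (s := {p}ᶜ))
      rwa [h0 k, norm_zero] at this
    simpa using ((hk 0).add (hk 1)).add (hk 2)
  have hκ' : 0 < 1 / (8 * κ) := by positivity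
  refine absurd (ge_of_tendsto (b := 1 / (8 * κ)) hlim ?_) (not_le.2 hκ')
  filter_upwards [hbound, hΨe 0, hΨe 1, hΨe 2] with z h1 h2 h3 h4
  rw [h2, h3, h4, norm_mul, norm_mul, norm_mul, ← mul_add, ← mul_add]
  exact ((h1 1 (by simp)).2).trans
    (mul_le_mul_of_nonneg_left (nullCurve_norm_ge g z) (norm_nonneg _))

end End

/-! ### The spinors of a minimal torus -/

lemma IsSpinorOn.symm {P U : Set ℂ} {A B C s₁ s₂ : ℂ → ℂ} (h : IsSpinorOn P A B C U s₁ s₂) :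
    IsSpinorOn P C B A U s₂ s₁ :=
  ⟨h.diff₂, h.diff₁, h.sq₂, fun z hz => by rw [mul_comm, h.mul z hz], h.sq₁⟩

/-- Square roots of a null curve with a double pole without residue have simple poles without
constant term. -/
lemma exists_hasOddPole {s₁ s₂ α β χ : ℂ → ℂ} {p : ℂ}
    (hd₁ : ∀ᶠ z in 𝓝[≠] p, DifferentiableAt ℂ s₁ z) (hd₂ : ∀ᶠ z in 𝓝[≠] p, DifferentiableAt ℂ s₂ z)
    (hα : AnalyticAt ℂ α p) (hβ : AnalyticAt ℂ β p) (hχ : AnalyticAt ℂ χ p)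
    (hα' : deriv α p = 0) (hβ' : deriv β p = 0) (hχ' : deriv χ p = 0)
    (h0 : α p ≠ 0 ∨ χ p ≠ 0)
    (h₁ : ∀ᶠ z in 𝓝[≠] p, s₁ z ^ 2 = α z / (z - p) ^ 2)
    (h₁₂ : ∀ᶠ z in 𝓝[≠] p, s₁ z * s₂ z = β z / (z - p) ^ 2)
    (h₂ : ∀ᶠ z in 𝓝[≠] p, s₂ z ^ 2 = χ z / (z - p) ^ 2) :
    ∃ a₁ a₂, HasOddPole s₁ p a₁ ∧ HasOddPole s₂ p a₂ ∧ (a₁ ≠ 0 ∨ a₂ ≠ 0) := by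
  have hext : ∀ {s α : ℂ → ℂ}, (∀ᶠ z in 𝓝[≠] p, DifferentiableAt ℂ s z) → AnalyticAt ℂ α p →
      (∀ᶠ z in 𝓝[≠] p, s z ^ 2 = α z / (z - p) ^ 2) →
      ∃ S, AnalyticAt ℂ S p ∧ S =ᶠ[𝓝[≠] p] fun z => (z - p) * s z := by
    intro s α hs hα h
    obtain ⟨M, hM⟩ := exists_eventually_norm_le_of_tendsto
      (hα.continuousAt.tendsto.mono_left (nhdsWithin_le_nhds (s := {p}ᶜ)))
    refine exists_analyticAt_eventuallyEq (M := M + 1) ?_ ?_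
    · filter_upwards [hs] with z hz
      fun_prop
    · filter_upwards [h, hM, self_mem_nhdsWithin] with z h1 h2 h3
      have e : ((z - p) * s z) ^ 2 = α z := by
        rw [mul_pow, h1, mul_div_cancel₀ _ (pow_ne_zero 2 (sub_ne_zero.2 h3))]
      rw [← e, norm_pow] at h2
      nlinarith [norm_nonneg ((z - p) * s z)]
  obtain ⟨S₁, hS₁, e₁⟩ := hext hd₁ hα h₁
  obtain ⟨S₂, hS₂, e₂⟩ := hext hd₂ hχ h₂
  have hprod : ∀ {S T s t α : ℂ → ℂ}, AnalyticAt ℂ S p → AnalyticAt ℂ T p → AnalyticAt ℂ α p →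
      S =ᶠ[𝓝[≠] p] (fun z => (z - p) * s z) → T =ᶠ[𝓝[≠] p] (fun z => (z - p) * t z) →
      (∀ᶠ z in 𝓝[≠] p, s z * t z = α z / (z - p) ^ 2) → deriv α p = 0 →
      S p * T p = α p ∧ deriv S p * T p + S p * deriv T p = 0 := by
    intro S T s t α hS hT hα eS eT h hα'
    have key : (fun z => S z * T z) =ᶠ[𝓝 p] α := by
      refine (ContinuousAt.eventuallyEq_nhds_iff_eventuallyEq_nhdsNE (hS.mul hT).continuousAt
        hα.continuousAt).1 ?_
      filter_upwards [eS, eT, h, self_mem_nhdsWithin] with z h1 h2 h3 h4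
      have h5 : z - p ≠ 0 := sub_ne_zero.2 h4
      rw [Pi.mul_apply, h1, h2, show (z - p) * s z * ((z - p) * t z) = (z - p) ^ 2 * (s z * t z) by ring,
        h3, mul_div_cancel₀ _ (pow_ne_zero 2 h5)]
    refine ⟨key.self_of_nhds, ?_⟩
    rw [← deriv_fun_mul hS.differentiableAt hT.differentiableAt, key.deriv_eq, hα']
  obtain ⟨v₁, d₁⟩ := hprod hS₁ hS₁ hα e₁ e₁ (by simpa only [sq] using h₁) hα'
  obtain ⟨-, d₁₂⟩ := hprod hS₁ hS₂ hβ e₁ e₂ h₁₂ hβ'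
  obtain ⟨v₂, d₂⟩ := hprod hS₂ hS₂ hχ e₂ e₂ (by simpa only [sq] using h₂) hχ'
  have hne : S₁ p ≠ 0 ∨ S₂ p ≠ 0 := by
    rw [← v₁, ← v₂] at h0
    simpa using h0
  have hz : deriv S₁ p = 0 ∧ deriv S₂ p = 0 := by
    rcases hne with h | h
    · have h1 : deriv S₁ p = 0 := (mul_eq_zero.1 (show deriv S₁ p * S₁ p = 0 by
        linear_combination d₁ / 2)).resolve_right h
      refine ⟨h1, (mul_eq_zero.1 (show S₁ p * deriv S₂ p = 0 by
        linear_combination d₁₂ - S₂ p * h1)).resolve_left h⟩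
    · have h1 : deriv S₂ p = 0 := (mul_eq_zero.1 (show deriv S₂ p * S₂ p = 0 by
        linear_combination d₂ / 2)).resolve_right h
      refine ⟨(mul_eq_zero.1 (show deriv S₁ p * S₂ p = 0 by
        linear_combination d₁₂ - S₁ p * h1)).resolve_right h, h1⟩
  have hdiv : ∀ {S s : ℂ → ℂ}, S =ᶠ[𝓝[≠] p] (fun z => (z - p) * s z) →
      ∀ᶠ z in 𝓝[≠] p, s z = S z / (z - p) := by
    intro S s h
    filter_upwards [h, self_mem_nhdsWithin] with z h1 h2
    rw [h1, mul_div_cancel_left₀ _ (sub_ne_zero.2 h2)]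
  exact ⟨S₁ p, S₂ p, ⟨S₁, hS₁, rfl, hz.1, hdiv e₁⟩, ⟨S₂, hS₂, rfl, hz.2, hdiv e₂⟩, hne⟩

/-- The points of `ℂ` over the ends. -/
def poles (f : ℂ → S3) : Set ℂ := {z | f z = OnePoint.infty}

lemma inversionChart_coe (x : E3) :
    inversionChart (x : S3) = EuclideanGeometry.inversion (0 : E3) 1 x := rfl

lemma affineChart_coe (x : E3) : affineChart (x : S3) = x := rfl

section Torus

variable {L : PeriodPair} {f : ℂ → S3} {z : ℂ}

namespace IsConformalImmersion

lemma isOpen_compl_poles (hf : IsConformalImmersion f) : IsOpen (poles f)ᶜ :=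
  (OnePoint.isClosed_infty.preimage hf.continuous).isOpen_compl

/-- Ends are isolated: the inverted chart has an isolated zero there. -/
lemma eventually_of_mem_poles (hf : IsConformalImmersion f) (hz : z ∈ poles f) :
    ∀ᶠ w in 𝓝[≠] z, w ∉ poles f ∧ (affineChart ∘ f) w =
      EuclideanGeometry.inversion (0 : E3) 1 ((inversionChart ∘ f) w) := by
  have hz' : f z = OnePoint.infty := hz
  have hne := eventually_ne_zero_of_conformalAt (y := inversionChart ∘ f)
    (by simp [inversionChart, hz']) (hf.smooth_infty z hz) (hf.conformal_infty z hz)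
  filter_upwards [hne] with w hw
  have hwP : w ∉ poles f := fun h => hw (by
    have h' : f w = OnePoint.infty := h
    simp [inversionChart, h'])
  refine ⟨hwP, ?_⟩
  obtain ⟨x, hx⟩ := OnePoint.ne_infty_iff_exists.1 (show f w ≠ OnePoint.infty from hwP)
  simp only [Function.comp_apply, ← hx, affineChart_coe, inversionChart_coe]
  rw [EuclideanGeometry.inversion_inversion _ one_ne_zero]

lemma eventually_notMem_poles (hf : IsConformalImmersion f) (z : ℂ) :
    ∀ᶠ w in 𝓝[≠] z, w ∉ poles f := by
  by_cases hz : z ∈ poles f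
  · exact (hf.eventually_of_mem_poles hz).mono fun _ => And.left
  · exact mem_nhdsWithin_of_mem_nhds (hf.isOpen_compl_poles.mem_nhds hz)

end IsConformalImmersion

namespace IsMinimalTorusWithPlanarEnds

lemma differentiableAt_nullCurve (hf : IsMinimalTorusWithPlanarEnds L f) (hz : z ∉ poles f)
    (k : Fin 3) : DifferentiableAt ℂ (nullCurve (affineChart ∘ f) k) z :=
  MinimalTorus.differentiableAt_nullCurve (hf.immersion.smooth_affine z hz)
    (Filter.mem_of_superset (hf.immersion.isOpen_compl_poles.mem_nhds hz)
      fun w hw => hf.immersion.conformal_affine w hw) (hf.minimal z hz) k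

lemma add_mem_poles_iff (hf : IsMinimalTorusWithPlanarEnds L f) {γ : ℂ} (hγ : γ ∈ L.lattice) :
    z + γ ∈ poles f ↔ z ∈ poles f := by
  obtain ⟨t, ht⟩ := hf.periods γ hγ
  simp only [poles, mem_ofPred_eq, ht z]
  cases f z using OnePoint.rec <;> simp

lemma nullCurve_add (hf : IsMinimalTorusWithPlanarEnds L f) {γ : ℂ} (hγ : γ ∈ L.lattice)
    (hz : z ∉ poles f) (k : Fin 3) :
    nullCurve (affineChart ∘ f) k (z + γ) = nullCurve (affineChart ∘ f) k z := by
  obtain ⟨t, ht⟩ := hf.periods γ hγ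
  have h : (fun w => (affineChart ∘ f) (w + γ)) =ᶠ[𝓝 z] fun w => (affineChart ∘ f) w + t := by
    filter_upwards [hf.immersion.isOpen_compl_poles.mem_nhds hz] with w hw
    obtain ⟨x, hx⟩ := OnePoint.ne_infty_iff_exists.1 (show f w ≠ OnePoint.infty from hw)
    simp only [Function.comp_apply, ht w, ← hx, OnePoint.map_some, affineChart_coe]
  have h2 : fderiv ℝ (affineChart ∘ f) (z + γ) = fderiv ℝ (affineChart ∘ f) z := by
    rw [← fderiv_comp_add_right, h.fderiv_eq, fderiv_add_const]
  simp only [nullCurve, dX, dY, h2]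

/-- The quadratic expressions in the spinors have double poles without residues at the ends. -/
lemma exists_form_expansion (hf : IsMinimalTorusWithPlanarEnds L f) (hz : z ∈ poles f) :
    ∃ α β χ : ℂ → ℂ, (AnalyticAt ℂ α z ∧ AnalyticAt ℂ β z ∧ AnalyticAt ℂ χ z) ∧
      (deriv α z = 0 ∧ deriv β z = 0 ∧ deriv χ z = 0) ∧ (α z ≠ 0 ∨ χ z ≠ 0) ∧
      ∀ᶠ w in 𝓝[≠] z, formA (affineChart ∘ f) w = α w / (w - z) ^ 2 ∧
        formB (affineChart ∘ f) w = β w / (w - z) ^ 2 ∧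
        formC (affineChart ∘ f) w = χ w / (w - z) ^ 2 := by
  have hev := hf.immersion.eventually_of_mem_poles hz
  have hz' : f z = OnePoint.infty := hz
  obtain ⟨Ψ, hΨ, k, hk⟩ := exists_planar_end_expansion (g := affineChart ∘ f)
    (y := inversionChart ∘ f) (by simp [inversionChart, hz']) (hf.immersion.smooth_infty z hz)
    (hf.immersion.conformal_infty z hz) (hev.mono fun w hw => hw.2)
    (fun k => hev.mono fun w hw => hf.differentiableAt_nullCurve hw.1 k)
  have a0 := (hΨ 0).1
  have a1 := (hΨ 1).1
  have a2 := (hΨ 2).1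
  have hα : AnalyticAt ℂ (fun w => (Ψ 1 w - I * Ψ 2 w) / 2) z :=
    (a1.sub (analyticAt_const.mul a2)).div analyticAt_const two_ne_zero
  have hβ : AnalyticAt ℂ (fun w => Ψ 0 w / 2) z := a0.div analyticAt_const two_ne_zero
  have hχ : AnalyticAt ℂ (fun w => (-Ψ 1 w - I * Ψ 2 w) / 2) z :=
    (a1.neg.sub (analyticAt_const.mul a2)).div analyticAt_const two_ne_zero
  have d0 := a0.differentiableAt.hasDerivAt
  have d1 := a1.differentiableAt.hasDerivAt
  have d2 := a2.differentiableAt.hasDerivAt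
  rw [(hΨ 0).2.1] at d0
  rw [(hΨ 1).2.1] at d1
  rw [(hΨ 2).2.1] at d2
  have hexp : ∀ᶠ w in 𝓝[≠] z,
      formA (affineChart ∘ f) w = ((Ψ 1 w - I * Ψ 2 w) / 2) / (w - z) ^ 2 ∧
      formB (affineChart ∘ f) w = (Ψ 0 w / 2) / (w - z) ^ 2 ∧
      formC (affineChart ∘ f) w = ((-Ψ 1 w - I * Ψ 2 w) / 2) / (w - z) ^ 2 := by
    filter_upwards [(hΨ 0).2.2, (hΨ 1).2.2, (hΨ 2).2.2] with w h0 h1 h2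
    unfold formA formB formC
    rw [h0, h1, h2]
    refine ⟨?_, ?_, ?_⟩ <;> ring
  refine ⟨_, _, _, ⟨hα, hβ, hχ⟩, ⟨?_, ?_, ?_⟩, ?_, hexp⟩
  · simpa using ((d1.sub (d2.const_mul I)).div_const 2).deriv
  · simpa using (d0.div_const 2).deriv
  · simpa using ((d1.neg.sub (d2.const_mul I)).div_const 2).deriv
  · by_contra! h
    obtain ⟨hA, hC⟩ := h
    -- the relation `B² = A C` passes to the leading coefficients
    have hnull : (Ψ 0 z / 2) ^ 2 =
        ((Ψ 1 z - I * Ψ 2 z) / 2) * ((-Ψ 1 z - I * Ψ 2 z) / 2) := by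
      have hl := (hβ.continuousAt.pow 2).tendsto.mono_left (nhdsWithin_le_nhds (s := {z}ᶜ))
      have hr := (hα.mul hχ).continuousAt.tendsto.mono_left (nhdsWithin_le_nhds (s := {z}ᶜ))
      refine tendsto_nhds_unique hl (hr.congr' ?_)
      filter_upwards [hexp, hev, self_mem_nhdsWithin] with w h1 h2 h3
      have h4 := formB_sq (hf.immersion.conformal_affine w h2.1)
      have h5 : w - z ≠ 0 := sub_ne_zero.2 h3
      rw [h1.1, h1.2.1, h1.2.2, div_pow, div_mul_div_comm,
        div_eq_div_iff (by positivity) (by positivity)] at h4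
      have h6 : ((w - z) ^ 2) ^ 2 ≠ 0 := pow_ne_zero 2 (pow_ne_zero 2 h5)
      refine (mul_right_cancel₀ h6 ?_).symm
      simp only [Pi.mul_apply, Pi.pow_apply]
      linear_combination h4
    rw [hA, zero_mul] at hnull
    have p0 : Ψ 0 z = 0 := by simpa using hnull
    have p1 : Ψ 1 z = 0 := by linear_combination hA - hC
    have p2 : Ψ 2 z = 0 := by
      have : I * Ψ 2 z = 0 := by linear_combination -hA - hC
      simpa using this
    fin_cases k
    exacts [hk p0, hk p1, hk p2]

end IsMinimalTorusWithPlanarEnds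

end Torus

/-! ### The induced spin structure -/

section SpinStructure

variable {L : PeriodPair} {f : ℂ → S3}

/-- The sign of `γ` under `h`, as a complex number. -/
def signOf (h : Multiplicative L.lattice →* ℤˣ) (γ : L.lattice) : ℂ :=
  ((h (Multiplicative.ofAdd γ) : ℤ) : ℂ)

lemma signOf_eq_one_or (h : Multiplicative L.lattice →* ℤˣ) (γ : L.lattice) :
    signOf h γ = 1 ∨ signOf h γ = -1 := by
  unfold signOf
  rcases Int.units_eq_one_or (h (Multiplicative.ofAdd γ)) with e | e <;> simp [e]

lemma signOf_add (h : Multiplicative L.lattice →* ℤˣ) (γ δ : L.lattice) :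
    signOf h (γ + δ) = signOf h γ * signOf h δ := by
  simp [signOf, ofAdd_add]

lemma signOf_neg (h : Multiplicative L.lattice →* ℤˣ) (γ : L.lattice) :
    signOf h (-γ) = signOf h γ := by
  have h1 := signOf_add h γ (-γ)
  have h0 : signOf h 0 = 1 := by simp [signOf]
  rw [add_neg_cancel, h0] at h1
  rcases signOf_eq_one_or h γ with e | e <;> rw [e] at h1 ⊢
  · linear_combination -h1
  · linear_combination h1

lemma signOf_injective {h h' : Multiplicative L.lattice →* ℤˣ}
    (H : ∀ γ, signOf h γ = signOf h' γ) : h = h' := by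
  ext γ
  have := H (Multiplicative.toAdd γ)
  unfold signOf at this
  exact_mod_cast this

/-- The spinors of `f` on the complement of the ends. -/
abbrev IsSpinorOf (f : ℂ → S3) (s₁ s₂ : ℂ → ℂ) : Prop :=
  IsSpinorOn (poles f) (formA (affineChart ∘ f)) (formB (affineChart ∘ f))
    (formC (affineChart ∘ f)) univ s₁ s₂

/-- The Weierstrass representation at a point, in terms of the three products of the spinors. -/
lemma weierstrass_iff (g : ℂ → E3) (z a b : ℂ) :
    (∀ v : ℂ, fderiv ℝ g z v = !₂[(2 * a * b * v).re, ((a ^ 2 - b ^ 2) * v).re,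
        (I * (a ^ 2 + b ^ 2) * v).re]) ↔
      a ^ 2 = formA g z ∧ a * b = formB g z ∧ b ^ 2 = formC g z := by
  have hre : ∀ {u w : ℂ}, (∀ v : ℂ, (u * v).re = (w * v).re) → u = w := by
    intro u w h
    have h1 := h 1
    have h2 := h I
    simp only [mul_one, mul_I_re] at h1 h2
    exact Complex.ext h1 (neg_injective h2)
  have hI := Complex.I_sq
  constructor
  · intro h
    have h0 : nullCurve g 0 z = 2 * a * b := hre fun v => by
      rw [← fderiv_apply_eq_re, h]; rfl
    have h1 : nullCurve g 1 z = a ^ 2 - b ^ 2 := hre fun v => by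
      rw [← fderiv_apply_eq_re, h]; rfl
    have h2 : nullCurve g 2 z = I * (a ^ 2 + b ^ 2) := hre fun v => by
      rw [← fderiv_apply_eq_re, h]; rfl
    unfold formA formB formC
    rw [h0, h1, h2]
    refine ⟨?_, by ring, ?_⟩
    · linear_combination (a ^ 2 + b ^ 2) / 2 * hI
    · linear_combination (a ^ 2 + b ^ 2) / 2 * hI
  · rintro ⟨hA, hB, hC⟩ v
    unfold formA at hA
    unfold formB at hB
    unfold formC at hC
    ext k
    rw [fderiv_apply_eq_re]
    fin_cases k
    · change (nullCurve g 0 z * v).re = (2 * a * b * v).re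
      congr 2; linear_combination -2 * hB
    · change (nullCurve g 1 z * v).re = ((a ^ 2 - b ^ 2) * v).re
      congr 2; linear_combination -hA + hC
    · change (nullCurve g 2 z * v).re = (I * (a ^ 2 + b ^ 2) * v).re
      congr 2
      linear_combination -I * (hA + hC) + nullCurve g 2 z * hI

lemma isInducedSpinStructure_iff (h : Multiplicative L.lattice →* ℤˣ) :
    IsInducedSpinStructure L f h ↔ ∃ s₁ s₂, IsSpinorOf f s₁ s₂ ∧
      ∀ γ : L.lattice, ∀ z ∉ poles f, s₁ (z + γ) = signOf h γ * s₁ z ∧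
        s₂ (z + γ) = signOf h γ * s₂ z := by
  have hset : univ \ poles f = {z | f z ≠ OnePoint.infty} := by ext z; simp [poles]
  constructor
  · rintro ⟨s₁, s₂, h1, h2, h3, h4⟩
    have h5 := fun z (hz : z ∈ univ \ poles f) => (weierstrass_iff _ z _ _).1 (h4 z hz.2)
    rw [← hset] at h1 h2
    exact ⟨s₁, s₂, ⟨h1, h2, fun z hz => (h5 z hz).1, fun z hz => (h5 z hz).2.1,
      fun z hz => (h5 z hz).2.2⟩, fun γ z hz => h3 γ z hz⟩
  · rintro ⟨s₁, s₂, hs, hm⟩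
    refine ⟨s₁, s₂, hset ▸ hs.diff₁, hset ▸ hs.diff₂, fun γ z hz => hm γ z hz, fun z hz => ?_⟩
    have hz' : z ∈ univ \ poles f := ⟨mem_univ z, hz⟩
    exact (weierstrass_iff _ z _ _).2 ⟨hs.sq₁ z hz', hs.mul z hz', hs.sq₂ z hz'⟩

lemma IsSpinorOf.ne_zero (hf : IsMinimalTorusWithPlanarEnds L f) {s₁ s₂ : ℂ → ℂ}
    (hs : IsSpinorOf f s₁ s₂) {z : ℂ} (hz : z ∉ poles f) : s₁ z ≠ 0 ∨ s₂ z ≠ 0 := by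
  have := formA_ne_zero_or_formC_ne_zero (hf.immersion.conformal_affine z hz)
  rw [← hs.sq₁ z ⟨mem_univ z, hz⟩, ← hs.sq₂ z ⟨mem_univ z, hz⟩] at this
  simpa using this

lemma IsSpinorOf.exists_sign (hf : IsMinimalTorusWithPlanarEnds L f) {s₁ s₂ t₁ t₂ : ℂ → ℂ}
    (hs : IsSpinorOf f s₁ s₂) (ht : IsSpinorOf f t₁ t₂) :
    ∃ ε : ℂ, (ε = 1 ∨ ε = -1) ∧ ∀ z ∉ poles f, t₁ z = ε * s₁ z ∧ t₂ z = ε * s₂ z := by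
  obtain ⟨ε, hε, h⟩ := IsSpinorOn.exists_sign hf.immersion.eventually_notMem_poles isOpen_univ
    isPreconnected_univ
    (fun z hz => formA_ne_zero_or_formC_ne_zero (hf.immersion.conformal_affine z hz.2)) hs ht
  exact ⟨ε, hε, fun z hz => h z ⟨mem_univ z, hz⟩⟩

namespace IsMinimalTorusWithPlanarEnds

theorem exists_isSpinorOf (hf : IsMinimalTorusWithPlanarEnds L f) :
    ∃ s₁ s₂, IsSpinorOf f s₁ s₂ := by
  set g := affineChart ∘ f
  have hP := hf.immersion.eventually_notMem_poles
  have hne : ∀ z ∉ poles f, formA g z ≠ 0 ∨ formC g z ≠ 0 := fun z hz =>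
    formA_ne_zero_or_formC_ne_zero (hf.immersion.conformal_affine z hz)
  have hnull : ∀ z ∉ poles f, formB g z ^ 2 = formA g z * formC g z := fun z hz =>
    formB_sq (hf.immersion.conformal_affine z hz)
  have hd : ∀ k, DifferentiableOn ℂ (nullCurve g k) (poles f)ᶜ := fun k z hz =>
    (hf.differentiableAt_nullCurve hz k).differentiableWithinAt
  have hA : DifferentiableOn ℂ (formA g) (poles f)ᶜ :=
    ((hd 1).sub ((hd 2).const_mul I)).div_const 2
  have hB : DifferentiableOn ℂ (formB g) (poles f)ᶜ := (hd 0).div_const 2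
  have hC : DifferentiableOn ℂ (formC g) (poles f)ᶜ :=
    ((hd 1).neg.sub ((hd 2).const_mul I)).div_const 2
  have hPo := hf.immersion.isOpen_compl_poles
  refine exists_isSpinorOn_univ hP hne fun p => ?_
  -- either the first or the last component of the null curve has even order `-2 n` at `p`
  obtain ⟨n, hn, a, ha, ha0, h⟩ : ∃ n : ℕ, (p ∉ poles f → n = 0) ∧ ∃ a, AnalyticAt ℂ a p ∧
      a p ≠ 0 ∧ ((∀ᶠ z in 𝓝 p, z ∉ poles f → formA g z = a z / ((z - p) ^ n) ^ 2) ∨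
        (∀ᶠ z in 𝓝 p, z ∉ poles f → formC g z = a z / ((z - p) ^ n) ^ 2)) := by
    by_cases hp : p ∈ poles f
    · obtain ⟨α, β, χ, ⟨hα, -, hχ⟩, -, h0, hev⟩ := hf.exists_form_expansion hp
      refine ⟨1, fun h => absurd hp h, ?_⟩
      simp only [pow_one]
      rw [eventually_nhdsWithin_iff] at hev
      have hzp : ∀ z ∉ poles f, z ∈ ({p}ᶜ : Set ℂ) := fun z hz h => hz (by rwa [h])
      rcases h0 with h0 | h0
      · exact ⟨α, hα, h0, Or.inl (hev.mono fun z hz hzP => (hz (hzp z hzP)).1)⟩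
      · exact ⟨χ, hχ, h0, Or.inr (hev.mono fun z hz hzP => (hz (hzp z hzP)).2.2)⟩
    · refine ⟨0, fun _ => rfl, ?_⟩
      rcases hne p hp with h0 | h0
      · exact ⟨_, hA.analyticAt (hPo.mem_nhds hp), h0, Or.inl (by simp)⟩
      · exact ⟨_, hC.analyticAt (hPo.mem_nhds hp), h0, Or.inr (by simp)⟩
  rcases h with h | h
  · exact exists_isSpinorOn_ball_of_left hP hB hnull hn ha ha0 h
  · obtain ⟨r, hr, s₁, s₂, hs⟩ := exists_isSpinorOn_ball_of_left hP hB
      (fun z hz => by rw [hnull z hz, mul_comm]) hn ha ha0 h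
    exact ⟨r, hr, s₂, s₁, hs.symm⟩

lemma isSpinorOf_comp_add (hf : IsMinimalTorusWithPlanarEnds L f) {s₁ s₂ : ℂ → ℂ}
    (hs : IsSpinorOf f s₁ s₂) {γ : ℂ} (hγ : γ ∈ L.lattice) :
    IsSpinorOf f (fun z => s₁ (z + γ)) (fun z => s₂ (z + γ)) := by
  have hmaps : MapsTo (fun z => z + γ) (univ \ poles f) (univ \ poles f) := fun z hz =>
    ⟨mem_univ _, fun h => hz.2 ((hf.add_mem_poles_iff hγ).1 h)⟩
  refine ⟨hs.diff₁.comp (by fun_prop) hmaps, hs.diff₂.comp (by fun_prop) hmaps,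
    fun z hz => ?_, fun z hz => ?_, fun z hz => ?_⟩
  · rw [hs.sq₁ _ (hmaps hz)]; simp only [formA, hf.nullCurve_add hγ hz.2]
  · rw [hs.mul _ (hmaps hz)]; simp only [formB, hf.nullCurve_add hγ hz.2]
  · rw [hs.sq₂ _ (hmaps hz)]; simp only [formC, hf.nullCurve_add hγ hz.2]

theorem exists_isInducedSpinStructure (hf : IsMinimalTorusWithPlanarEnds L f) :
    ∃ h, IsInducedSpinStructure L f h := by
  obtain ⟨s₁, s₂, hs⟩ := hf.exists_isSpinorOf
  have hu : ∀ γ : L.lattice, ∃ u : ℤˣ, ∀ z ∉ poles f,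
      s₁ (z + γ) = ((u : ℤ) : ℂ) * s₁ z ∧ s₂ (z + γ) = ((u : ℤ) : ℂ) * s₂ z := by
    intro γ
    obtain ⟨ε, hε | hε, h⟩ := IsSpinorOf.exists_sign hf hs (hf.isSpinorOf_comp_add hs γ.2)
    · exact ⟨1, by simpa [hε] using h⟩
    · exact ⟨-1, by simpa [hε] using h⟩
  choose u hu using hu
  obtain ⟨z, hz⟩ := (hf.immersion.eventually_notMem_poles 0).exists
  have hmul : ∀ γ δ : L.lattice, u (γ + δ) = u γ * u δ := by
    intro γ δ
    have hz' : z + δ ∉ poles f := fun h => hz ((hf.add_mem_poles_iff δ.2).1 h)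
    have h1 := hu (γ + δ) z hz
    have h2 := hu γ (z + δ) hz'
    have h3 := hu δ z hz
    rw [show z + ((γ + δ : L.lattice) : ℂ) = z + δ + γ by push_cast; ring] at h1
    rw [h1.1, h1.2, h3.1, h3.2, ← mul_assoc, ← mul_assoc] at h2
    have key : ((u (γ + δ) : ℤ) : ℂ) = ((u γ : ℤ) : ℂ) * ((u δ : ℤ) : ℂ) := by
      rcases hs.ne_zero hf hz with h | h
      · exact mul_right_cancel₀ h h2.1
      · exact mul_right_cancel₀ h h2.2
    ext
    exact_mod_cast key
  exact ⟨MonoidHom.mk' (fun γ => u (Multiplicative.toAdd γ)) fun γ δ => hmul _ _,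
    (isInducedSpinStructure_iff _).2 ⟨s₁, s₂, hs, fun γ z hz => hu γ z hz⟩⟩

theorem isInducedSpinStructure_unique (hf : IsMinimalTorusWithPlanarEnds L f)
    {h h' : Multiplicative L.lattice →* ℤˣ} (H : IsInducedSpinStructure L f h)
    (H' : IsInducedSpinStructure L f h') : h' = h := by
  obtain ⟨s₁, s₂, hs, hm⟩ := (isInducedSpinStructure_iff h).1 H
  obtain ⟨t₁, t₂, ht, hm'⟩ := (isInducedSpinStructure_iff h').1 H'
  obtain ⟨ε, -, hε⟩ := IsSpinorOf.exists_sign hf ht hs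
  obtain ⟨z, hz⟩ := (hf.immersion.eventually_notMem_poles 0).exists
  refine signOf_injective fun γ => ?_
  have hz' : z + γ ∉ poles f := fun h => hz ((hf.add_mem_poles_iff γ.2).1 h)
  have h1 := hε z hz
  have h2 := hε (z + γ) hz'
  have h3 := hm γ z hz
  have h4 := hm' γ z hz
  rcases hs.ne_zero hf hz with h0 | h0
  · refine mul_right_cancel₀ h0 ?_
    rw [← h3.1, h2.1, h4.1, h1.1]; ring
  · refine mul_right_cancel₀ h0 ?_
    rw [← h3.2, h2.2, h4.2, h1.2]; ring

lemma exists_hasOddPole (hf : IsMinimalTorusWithPlanarEnds L f) {s₁ s₂ : ℂ → ℂ}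
    (hs : IsSpinorOf f s₁ s₂) {p : ℂ} (hp : p ∈ poles f) :
    ∃ a₁ a₂, HasOddPole s₁ p a₁ ∧ HasOddPole s₂ p a₂ ∧ (a₁ ≠ 0 ∨ a₂ ≠ 0) := by
  obtain ⟨α, β, χ, ⟨hα, hβ, hχ⟩, ⟨hα', hβ', hχ'⟩, h0, hev⟩ := hf.exists_form_expansion hp
  have hP := hf.immersion.eventually_notMem_poles p
  have hop : ∀ z ∉ poles f, univ \ poles f ∈ 𝓝 z := fun z hz =>
    (isOpen_univ.inter hf.immersion.isOpen_compl_poles).mem_nhds ⟨mem_univ z, hz⟩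
  refine MinimalTorus.exists_hasOddPole (hP.mono fun z hz => hs.diff₁.differentiableAt (hop z hz))
    (hP.mono fun z hz => hs.diff₂.differentiableAt (hop z hz)) hα hβ hχ hα' hβ' hχ' h0 ?_ ?_ ?_
  · filter_upwards [hP, hev] with z h1 h2
    rw [hs.sq₁ z ⟨mem_univ z, h1⟩, h2.1]
  · filter_upwards [hP, hev] with z h1 h2
    rw [hs.mul z ⟨mem_univ z, h1⟩, h2.2.1]
  · filter_upwards [hP, hev] with z h1 h2
    rw [hs.sq₂ z ⟨mem_univ z, h1⟩, h2.2.2]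

/-- If there are two ends, every lattice vector `γ ∉ 2Γ` on which the spin structure is trivial
has its half as the difference of the ends. -/
theorem half_sub_mem_lattice (hf : IsMinimalTorusWithPlanarEnds L f) {p₁ p₂ : ℂ}
    (hP : poles f = twoCosets L p₁ p₂) {h : Multiplicative L.lattice →* ℤˣ}
    (H : IsInducedSpinStructure L f h) (γ : L.lattice) (hγ : signOf h γ = 1)
    (hγ2 : (γ : ℂ) / 2 ∉ L.lattice) : p₁ + γ / 2 - p₂ ∈ L.lattice := by
  obtain ⟨s₁, s₂, hs, hm⟩ := (isInducedSpinStructure_iff h).1 H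
  obtain ⟨a₁, a₂, ha₁, ha₂, ha⟩ := hf.exists_hasOddPole hs (p := p₁) (by rw [hP]; simp [twoCosets])
  obtain ⟨b₁, b₂, hb₁, hb₂, hb⟩ := hf.exists_hasOddPole hs (p := p₂) (by rw [hP]; simp [twoCosets])
  have hne := fun z (hz : z ∉ poles f) => hs.ne_zero hf hz
  have hd₁ := hs.diff₁
  have hd₂ := hs.diff₂
  rw [← compl_eq_univ_sdiff, hP] at hd₁ hd₂
  rw [hP] at hm hne
  exact IsTwoEndedSpinor.half_sub_mem_lattice (e := signOf h) ⟨hd₁, hd₂, hne, signOf_eq_one_or h,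
    signOf_neg h, fun γ z hz => (hm γ z hz).1, fun γ z hz => (hm γ z hz).2, ha₁, ha₂, hb₁, hb₂,
    ha, hb⟩ γ hγ hγ2

end IsMinimalTorusWithPlanarEnds

end SpinStructure

/-! ### Half periods -/

section HalfPeriods

variable {L : PeriodPair} {f : ℂ → S3}

lemma mkQ_eq_mkQ_iff {z w : ℂ} : L.lattice.mkQ z = L.lattice.mkQ w ↔ z - w ∈ L.lattice := by
  rw [Submodule.mkQ_apply, Submodule.mkQ_apply, Submodule.Quotient.eq]

lemma IsMinimalTorusWithPlanarEnds.mem_poles_iff (hf : IsMinimalTorusWithPlanarEnds L f) {z : ℂ} :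
    z ∈ poles f ↔ L.lattice.mkQ z ∈ ends L f := by
  refine ⟨fun h => mem_image_of_mem _ h, ?_⟩
  rintro ⟨w, hw, hwz⟩
  have h := mkQ_eq_mkQ_iff.1 hwz.symm
  have h2 := (hf.add_mem_poles_iff h (z := w)).2 hw
  rwa [add_sub_cancel] at h2

lemma IsMinimalTorusWithPlanarEnds.exists_poles_eq_twoCosets
    (hf : IsMinimalTorusWithPlanarEnds L f) (hends : (ends L f).ncard = 2) {p : Torus L}
    (hp : p ∈ ends L f) : ∃ p₁ p₂ : ℂ, L.lattice.mkQ p₁ = p ∧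
      ends L f = {L.lattice.mkQ p₁, L.lattice.mkQ p₂} ∧ poles f = twoCosets L p₁ p₂ := by
  obtain ⟨q, hq⟩ : ∃ q, ends L f = {p, q} := by
    obtain ⟨x, y, -, hxy⟩ := Set.ncard_eq_two.1 hends
    rw [hxy] at hp
    rcases hp with rfl | rfl
    · exact ⟨y, hxy⟩
    · exact ⟨x, by rw [hxy, Set.pair_comm]⟩
  obtain ⟨p₁, rfl⟩ := Submodule.mkQ_surjective _ p
  obtain ⟨p₂, rfl⟩ := Submodule.mkQ_surjective _ q
  refine ⟨p₁, p₂, rfl, hq, ?_⟩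
  ext z
  rw [hf.mem_poles_iff, hq, mem_insert_iff, mem_singleton_iff, mkQ_eq_mkQ_iff, mkQ_eq_mkQ_iff]
  rfl

lemma half_add_half_notMem_lattice (L : PeriodPair) : (L.ω₁ + L.ω₂) / 2 ∉ L.lattice := by
  have h : ((1 / 2 : ℚ) : ℂ) * L.ω₁ + ((1 / 2 : ℚ) : ℂ) * L.ω₂ ∉ L.lattice := by
    rw [PeriodPair.mul_ω₁_add_mul_ω₂_mem_lattice]
    norm_num
  have e : (L.ω₁ + L.ω₂) / 2 = ((1 / 2 : ℚ) : ℂ) * L.ω₁ + ((1 / 2 : ℚ) : ℂ) * L.ω₂ := by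
    push_cast
    ring
  rwa [e]

end HalfPeriods

end MinimalTorus

end

theorem mainTheorem8 (L : PeriodPair) (f : ℂ → MinimalTorus.S3)
    (hf : MinimalTorus.IsMinimalTorusWithPlanarEnds L f)
    (hends : (MinimalTorus.ends L f).ncard = 2) :
    (∃ h : Multiplicative L.lattice →* ℤˣ,
      (∀ h', MinimalTorus.IsInducedSpinStructure L f h' ↔ h' = h) ∧ h ≠ 1) ∧
    (∀ p ∈ MinimalTorus.ends L f, ∃ q ∈ MinimalTorus.halfPeriods L, q ≠ 0 ∧
      MinimalTorus.ends L f = {p, p + q}) := by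
  open MinimalTorus in
  obtain ⟨h, hh⟩ := hf.exists_isInducedSpinStructure
  refine ⟨⟨h, fun h' => ⟨fun H => hf.isInducedSpinStructure_unique hh H, fun e => e ▸ hh⟩, ?_⟩, ?_⟩
  · -- for the trivial spin structure the difference of the ends would be two half periods at once
    rintro rfl
    obtain ⟨p, hp⟩ : (ends L f).Nonempty := Set.nonempty_of_ncard_ne_zero (by rw [hends]; norm_num)
    obtain ⟨p₁, p₂, -, -, hP⟩ := hf.exists_poles_eq_twoCosets hends hp
    have h1 : p₁ + L.ω₁ / 2 - p₂ ∈ L.lattice :=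
      hf.half_sub_mem_lattice hP hh ⟨L.ω₁, L.ω₁_mem_lattice⟩ (by simp [signOf])
        L.ω₁_div_two_notMem_lattice
    have h2 : p₁ + L.ω₂ / 2 - p₂ ∈ L.lattice :=
      hf.half_sub_mem_lattice hP hh ⟨L.ω₂, L.ω₂_mem_lattice⟩ (by simp [signOf])
        L.ω₂_div_two_notMem_lattice
    have h3 : (L.ω₁ + L.ω₂) / 2 =
        p₁ + L.ω₁ / 2 - p₂ - (p₁ + L.ω₂ / 2 - p₂) + L.ω₂ := by ring
    exact half_add_half_notMem_lattice L
      (h3 ▸ add_mem (sub_mem h1 h2) L.ω₂_mem_lattice)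
  · intro p hp
    obtain ⟨p₁, p₂, rfl, he, hP⟩ := hf.exists_poles_eq_twoCosets hends hp
    -- the spin structure is trivial on one of `ω₁`, `ω₂` and `ω₁ + ω₂`
    obtain ⟨γ, hγ, hγ2, hγh⟩ : ∃ γ : L.lattice, signOf h γ = 1 ∧ (γ : ℂ) / 2 ∉ L.lattice ∧
        L.lattice.mkQ ((γ : ℂ) / 2) ∈ halfPeriods L := by
      have h12 := signOf_add h ⟨L.ω₁, L.ω₁_mem_lattice⟩ ⟨L.ω₂, L.ω₂_mem_lattice⟩
      rcases signOf_eq_one_or h ⟨L.ω₁, L.ω₁_mem_lattice⟩ with e₁ | e₁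
      · exact ⟨_, e₁, L.ω₁_div_two_notMem_lattice, by simp [halfPeriods]⟩
      rcases signOf_eq_one_or h ⟨L.ω₂, L.ω₂_mem_lattice⟩ with e₂ | e₂
      · exact ⟨_, e₂, L.ω₂_div_two_notMem_lattice, by simp [halfPeriods]⟩
      rw [e₁, e₂] at h12
      exact ⟨_, h12.trans (by norm_num), half_add_half_notMem_lattice L, by simp [halfPeriods]⟩
    refine ⟨_, hγh, ?_, ?_⟩
    · rwa [Ne, Submodule.mkQ_apply, Submodule.Quotient.mk_eq_zero]
    · rw [← map_add, mkQ_eq_mkQ_iff.2 (hf.half_sub_mem_lattice hP hh γ hγ hγ2), he]
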